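/- **Setting.** For $n\ge 0$ let $S:[0,1]\times\mathbb R\to \mathrm{Mat}(n,\mathbb R)$ be a continuous (in particular, possibly smooth) family of matrices, $S_\lambda:=S(\lambda,\cdot)$, and consider the linear systems $u'(t)=S_\lambda(t)u(t)$, $t\in\mathbb R$, $\lim_{t\to\pm\infty}u(t)=0$ (for instance the linearizations $S_\lambda(t)=D_zg(\lambda,t,z_\lambda(t))$ of a family of vector fields $g$ along heteroclinic orbits $z_\lambda$). For a real matrix $A$ let $V^{+}(A)$, resp. $V^-(A)$, be the real spectral subspace of $A$ belonging to the eigenvalues with positive, resp. negative, real part. Two subspaces $V,W\subset\mathbb R^n$ are transversal, $V\pitchfork W$, if $V+W=\mathbb R^n$. Subspaces carry the gap metric $\|P_V-P_W\|$, where $P_V$ is the orthogonal projection onto $V$. Let $\gamma_{\lambda,\tau}$ be the matrix solution of $\gamma'=S_\lambda(t)\gamma$, $\gamma(\tau)=I$, and $$E^s_\lambda(\tau)=\{v\in\mathbb R^n:\lim_{t\to+\infty}\gamma_{\lambda,\tau}(t)v=0\},\qquad E^u_\lambda(\tau)=\{v\in\mathbb R^n:\lim_{t\to-\infty}\gamma_{\lambda,\tau}(t)v=0\}.$$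 **The $\mathbb Z_2$-index.** Let $V,W$ be continuous paths of subspaces of $\mathbb R^n$ over $[a,b]$, of constant complementary dimensions, with $V(a)\pitchfork W(a)$ and $V(b)\pitchfork W(b)$. Choose continuous frames of $V$ and $W$ over $[a,b]$ and let $M(t)$ be the square matrix whose columns are the frame of $V(t)$ followed by that of $W(t)$. Then $\iota(V(t),W(t);t\in[a,b])$ is $0$ if $\det(M(a)M(b))>0$ and $1$ if $\det(M(a)M(b))<0$. For continuous paths over $[a,+\infty)$ that are transversal at $a$ and for all $t\ge T$, where $T>a$, put $\iota(V(t),W(t);t\in[a,+\infty)):=\iota(V(t),W(t);t\in[a,T])$. Neither definition depends on the choices made. The geometrical parity of $S_\lambda$ (of the orbit $z_\lambda$, if $S_\lambda$ is the linearization along $z_\lambda$) is $$\iota_{\rm geo}(S_\lambda):=\iota\big(E^s_\lambda(t),E^u_\lambda(-t);t\in[0,+\infty)\big).$$ **Assumptions.** - (A1) As $t\to\pm\infty$, $S_\lambda(t)$ converges, uniformly in $\lambda\in[0,1]$, to matrices $S^\pm_\lambda$, and no $S^\pm_\lambda$ has a spectral point on the imaginary axis. - (A2) For $\lambda=0$ and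 $\lambda=1$, the only solution of $u'=S_\lambda(t)u$ with $\lim_{t\to\pm\infty}u(t)=0$ is $u\equiv0$. - (A3) There is $k$ such that $\dim V^+(S^-_\lambda)=k$ and $\dim V^-(S^+_\lambda)=n-k$ for all $\lambda\in[0,1]$. - Boundary nondegeneracy: $V^-(S^+_0)\pitchfork V^+(S^-_0)$ and $V^-(S^+_1)\pitchfork V^+(S^-_1)$. **Proposition.** Under these assumptions the four $\mathbb Z_2$-indices below are well defined, i.e. the paths are continuous, of constant complementary dimensions ($\dim E^u_\lambda=k$, $\dim E^s_\lambda=n-k$), and transversal where the definition requires it; and $$\iota\big(E^u_\lambda(0),E^s_\lambda(0);\lambda\in[0,1]\big)\equiv \iota_{\rm geo}(S_0)+\iota_{\rm geo}(S_1)+\iota\big(V^-(S^+_\lambda),V^+(S^-_\lambda);\lambda\in[0,1]\big)\pmod 2 .$$ -/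

import Mathlib

open Set Filter Topology

namespace HeteroclinicParity

/-- Transversality of two linear subspaces: their sum is the whole space. -/
def Transversal {n : ℕ} (V W : Submodule ℝ (EuclideanSpace ℝ (Fin n))) : Prop :=
  V ⊔ W = ⊤

/-- The path of subspaces `V` is continuous on `s` for the gap metric
`d(V, W) = ‖P_V - P_W‖`, where `P_V` is the orthogonal projection onto `V`. -/
def GapContinuousOn {n : ℕ} (V : ℝ → Submodule ℝ (EuclideanSpace ℝ (Fin n))) (s : Set ℝ) : Prop :=
  ContinuousOn (fun t => (V t).starProjection) s

/-- `(V, W)` restricted to `[a, b]` is a pair of continuous paths in `Gr_k(n) × Gr_{n-k}(n)` with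
transversal ends. -/
structure IsTransversalPair {n : ℕ} (V W : ℝ → Submodule ℝ (EuclideanSpace ℝ (Fin n)))
    (a b : ℝ) (k : ℕ) : Prop where
  continuous_left : GapContinuousOn V (Icc a b)
  continuous_right : GapContinuousOn W (Icc a b)
  finrank_left : ∀ t ∈ Icc a b, Module.finrank ℝ (V t) = k
  finrank_right : ∀ t ∈ Icc a b, Module.finrank ℝ (W t) = n - k
  transversal_start : Transversal (V a) (W a)
  transversal_end : Transversal (V b) (W b)

/-- `(V, W)` restricted to `[a, +∞)` is a pair of continuous paths in `Gr_k(n) × Gr_{n-k}(n)`,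
transversal at `a` and for all large times. -/
structure IsTransversalPairIci {n : ℕ} (V W : ℝ → Submodule ℝ (EuclideanSpace ℝ (Fin n)))
    (a : ℝ) (k : ℕ) : Prop where
  continuous_left : GapContinuousOn V (Ici a)
  continuous_right : GapContinuousOn W (Ici a)
  finrank_left : ∀ t ∈ Ici a, Module.finrank ℝ (V t) = k
  finrank_right : ∀ t ∈ Ici a, Module.finrank ℝ (W t) = n - k
  transversal_start : Transversal (V a) (W a)
  eventually_transversal : ∃ T, a < T ∧ ∀ t, T ≤ t → Transversal (V t) (W t)

/-- `v` is a continuous frame of the path of subspaces `V` over `[a, b]`. -/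
def IsFrame {n k : ℕ} (V : ℝ → Submodule ℝ (EuclideanSpace ℝ (Fin n))) (a b : ℝ)
    (v : ℝ → Fin k → EuclideanSpace ℝ (Fin n)) : Prop :=
  ContinuousOn v (Icc a b) ∧
    ∀ t ∈ Icc a b, LinearIndependent ℝ (v t) ∧ Submodule.span ℝ (range (v t)) = V t

/-- The square matrix `[v₁ | ⋯ | v_k | w₁ | ⋯ | w_l]` with the given columns, `k + l = n`. -/
def frameMatrix {n k l : ℕ} (h : k + l = n) (v : Fin k → EuclideanSpace ℝ (Fin n))
    (w : Fin l → EuclideanSpace ℝ (Fin n)) : Matrix (Fin n) (Fin n) ℝ :=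
  Matrix.of fun i j => Fin.append v w (Fin.cast h.symm j) i

open Classical in
/-- The `ℤ₂`-index of the pair of paths `(V, W)` over `[a, b]`: with `M t` the matrix whose columns
are continuous frames of `V` and `W`, it is `1` if `det (M a * M b) < 0` and `0` if
`det (M a * M b) > 0`. (For continuous paths of complementary dimensions with transversal ends,
frames exist and the sign does not depend on them.) -/
noncomputable def z2Index {n : ℕ} (V W : ℝ → Submodule ℝ (EuclideanSpace ℝ (Fin n)))
    (a b : ℝ) : ℤ :=
  if ∃ (k l : ℕ) (h : k + l = n) (v : ℝ → Fin k → EuclideanSpace ℝ (Fin n))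
      (w : ℝ → Fin l → EuclideanSpace ℝ (Fin n)),
      IsFrame V a b v ∧ IsFrame W a b w ∧
        (frameMatrix h (v a) (w a) * frameMatrix h (v b) (w b)).det < 0
  then 1 else 0

open Classical in
/-- The `ℤ₂`-index over `[a, +∞)` of a pair that is transversal for all `t ≥ T`: the index over
`[a, T]`, for any such `T` (it does not depend on the choice). -/
noncomputable def z2IndexIci {n : ℕ} (V W : ℝ → Submodule ℝ (EuclideanSpace ℝ (Fin n)))
    (a : ℝ) : ℤ :=
  if h : ∃ T, a < T ∧ ∀ t, T ≤ t → Transversal (V t) (W t)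
  then z2Index V W a h.choose else 0

/-- A real matrix is hyperbolic if its (complex) spectrum does not meet the imaginary axis. -/
def IsHyperbolic {n : ℕ} (A : Matrix (Fin n) (Fin n) ℝ) : Prop :=
  ∀ μ ∈ spectrum ℂ (A.map (fun x : ℝ => (x : ℂ))), μ.re ≠ 0

/-- The real spectral subspace of `A` for a set `σ` of complex numbers: the real vectors in the sum
of the generalized eigenspaces of the complexification of `A` at the points of `σ`. -/
def spectralSubspace {n : ℕ} (A : Matrix (Fin n) (Fin n) ℝ) (σ : Set ℂ) :
    Submodule ℝ (EuclideanSpace ℝ (Fin n)) where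
  carrier := {v | (fun i => ((v i : ℝ) : ℂ)) ∈
    ⨆ μ ∈ σ, Module.End.maxGenEigenspace (Matrix.toLin' (A.map (fun x : ℝ => (x : ℂ)))) μ}
  zero_mem' := by
    have h : (fun i => (((0 : EuclideanSpace ℝ (Fin n)) i : ℝ) : ℂ)) = 0 := by
      ext i; simp
    simp only [mem_ofPred_eq]
    rw [h]
    exact Submodule.zero_mem _
  add_mem' := by
    intro v w hv hw
    have h : (fun i => (((v + w) i : ℝ) : ℂ)) =
        (fun i => ((v i : ℝ) : ℂ)) + fun i => ((w i : ℝ) : ℂ) := by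
      ext i; simp
    simp only [mem_ofPred_eq] at hv hw ⊢
    rw [h]
    exact Submodule.add_mem _ hv hw
  smul_mem' := by
    intro c v hv
    have h : (fun i => (((c • v) i : ℝ) : ℂ)) = (c : ℂ) • fun i => ((v i : ℝ) : ℂ) := by
      ext i; simp
    simp only [mem_ofPred_eq] at hv ⊢
    rw [h]
    exact Submodule.smul_mem _ _ hv

/-- The positive spectral subspace `V⁺(A)`. -/
def Vplus {n : ℕ} (A : Matrix (Fin n) (Fin n) ℝ) : Submodule ℝ (EuclideanSpace ℝ (Fin n)) :=
  spectralSubspace A {μ | 0 < μ.re}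

/-- The negative spectral subspace `V⁻(A)`. -/
def Vminus {n : ℕ} (A : Matrix (Fin n) (Fin n) ℝ) : Submodule ℝ (EuclideanSpace ℝ (Fin n)) :=
  spectralSubspace A {μ | μ.re < 0}

/-- `u` solves `u' = S(t) u` on the whole real line. -/
def IsSolution {n : ℕ} (S : ℝ → Matrix (Fin n) (Fin n) ℝ) (u : ℝ → EuclideanSpace ℝ (Fin n)) :
    Prop :=
  ∀ t, HasDerivAt u (Matrix.toEuclideanLin (S t) (u t)) t

/-- `γ` solves the matrix initial value problem `γ' = S(t) γ`, `γ(τ) = I`. -/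
def IsFundamentalSolution {n : ℕ} (S : ℝ → Matrix (Fin n) (Fin n) ℝ) (τ : ℝ)
    (γ : ℝ → Matrix (Fin n) (Fin n) ℝ) : Prop :=
  (∀ t i j, HasDerivAt (fun s => γ s i j) ((S t * γ t) i j) t) ∧ γ τ = 1

/-- The fundamental solution `γ_τ` of `u' = S(t) u` (it exists and is unique for continuous
`S`). -/
noncomputable def fundamentalSolution {n : ℕ} (S : ℝ → Matrix (Fin n) (Fin n) ℝ) (τ : ℝ) :
    ℝ → Matrix (Fin n) (Fin n) ℝ :=
  Classical.epsilon (IsFundamentalSolution S τ)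

/-- The initial values `v` for which `γ_τ(t) v → 0` along the filter `l`. -/
def decaySubspace {n : ℕ} (S : ℝ → Matrix (Fin n) (Fin n) ℝ) (τ : ℝ) (l : Filter ℝ) :
    Submodule ℝ (EuclideanSpace ℝ (Fin n)) where
  carrier := {v | Tendsto (fun t => Matrix.toEuclideanLin (fundamentalSolution S τ t) v) l (𝓝 0)}
  zero_mem' := by
    simp only [mem_ofPred_eq, map_zero]
    exact tendsto_const_nhds
  add_mem' := by
    intro v w hv hw
    simp only [mem_ofPred_eq, map_add] at hv hw ⊢
    simpa using hv.add hw
  smul_mem' := by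
    intro c v hv
    simp only [mem_ofPred_eq, map_smul] at hv ⊢
    simpa using hv.const_smul c

/-- The stable subspace `E^s(τ)` of `u' = S(t) u`. -/
def stableSubspace {n : ℕ} (S : ℝ → Matrix (Fin n) (Fin n) ℝ) (τ : ℝ) :
    Submodule ℝ (EuclideanSpace ℝ (Fin n)) :=
  decaySubspace S τ atTop

/-- The unstable subspace `E^u(τ)` of `u' = S(t) u`. -/
def unstableSubspace {n : ℕ} (S : ℝ → Matrix (Fin n) (Fin n) ℝ) (τ : ℝ) :
    Submodule ℝ (EuclideanSpace ℝ (Fin n)) :=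
  decaySubspace S τ atBot

/-- The geometrical parity `ι(S)`: the `ℤ₂`-index of `(E^s(t), E^u(-t))` over `t ∈ [0, +∞)`. -/
noncomputable def geometricalParity {n : ℕ} (S : ℝ → Matrix (Fin n) (Fin n) ℝ) : ℤ :=
  z2IndexIci (fun t => stableSubspace S t) (fun t => unstableSubspace S (-t)) 0

end HeteroclinicParity

/-! The substitution `s = t / (1 + t)` turns the half-line of times into `[0, 1)`. On the square of
pairs `(λ, s)` put `E^s_λ(t)` and `E^u_λ(-t)` for `s < 1`, and the limits `V⁻(S⁺_λ)` and `V⁺(S⁻_λ)`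
for `s = 1`. Both families are continuous on the closed square (`exists_stable_family`,
`exists_unstable_family`). The square is star-shaped, so both have global continuous frames
(`exists_frame_of_starConvex`). The determinant `D` of the joined frames is then one continuous
function on the square. It is nonzero at the four corners: by (A2) where `s = 0`, by boundary
nondegeneracy where `s = 1`. Each of the four indices records whether `D` changes sign along one
edge (`z2Index_eq`, `z2IndexIci_eq`), and around a closed loop the number of sign changes is even
(`ite_mul_neg_modEq`).

The analytic content is continuity up to `s = 1`. A hyperbolic `A` admits a symmetric form `B` with
`B (A v) v ≥ c ‖v‖²` (`exists_form_of_re_eigenvalue_ne_zero`), and with a smaller constant the same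
`B` serves all nearby operators. Along solutions `B` increases, so a solution decays exactly when `B
≤ 0` along it at all late times (`mem_stableSpace_of_form_nonpos`). This condition is closed: limits
of stable vectors are stable. The dimension is the negative index of `B` (`finrank_stableSpace`),
hence constant, and compactness of the set of projections upgrades closedness to gap continuity
(`tendsto_starProjection_of_limits_mem`). Unstable subspaces follow by reversing time. -/

namespace HeteroclinicParity

/-! ### Linear equations: existence, uniqueness, continuous dependence. -/

section LinearODE

variable {F : Type*} [NormedAddCommGroup F] [NormedSpace ℝ F]

/-- `u` solves the linear equation `u' = A(t) u` on the whole real line. -/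
def IsLinearSolution (A : ℝ → F →L[ℝ] F) (u : ℝ → F) : Prop :=
  ∀ t, HasDerivAt u (A t (u t)) t

namespace IsLinearSolution

variable {A : ℝ → F →L[ℝ] F} {u v : ℝ → F}

theorem continuous (hu : IsLinearSolution A u) : Continuous u :=
  continuous_iff_continuousAt.2 fun t => (hu t).continuousAt

theorem zero (A : ℝ → F →L[ℝ] F) : IsLinearSolution A fun _ => 0 := fun t => by
  simpa using hasDerivAt_const t (0 : F)

theorem add (hu : IsLinearSolution A u) (hv : IsLinearSolution A v) :
    IsLinearSolution A fun t => u t + v t := fun t => by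
  simpa using (hu t).fun_add (hv t)

theorem sub (hu : IsLinearSolution A u) (hv : IsLinearSolution A v) :
    IsLinearSolution A fun t => u t - v t := fun t => by
  simpa using (hu t).fun_sub (hv t)

theorem const_smul (hu : IsLinearSolution A u) (c : ℝ) :
    IsLinearSolution A fun t => c • u t := fun t => by
  simpa using (hu t).fun_const_smul c

theorem comp_add_const (hu : IsLinearSolution A u) (τ : ℝ) :
    IsLinearSolution (fun t => A (t + τ)) fun t => u (t + τ) := fun t =>
  (hu (t + τ)).comp_add_const t τ

theorem comp_neg (hu : IsLinearSolution A u) :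
    IsLinearSolution (fun t => -A (-t)) fun t => u (-t) := fun t => by
  have := (hu (-t)).scomp t (hasDerivAt_neg t)
  simpa [Function.comp_def] using this

end IsLinearSolution

theorem exists_bound_Icc {A : ℝ → F →L[ℝ] F} (hA : Continuous A) (a b : ℝ) :
    ∃ K : ℝ, 0 ≤ K ∧ ∀ t ∈ Icc a b, ‖A t‖ ≤ K := by
  obtain ⟨K, hK⟩ := isCompact_Icc.exists_bound_of_continuousOn (hA.continuousOn (s := Icc a b))
  exact ⟨max K 0, le_max_right _ _, fun t ht => (hK t ht).trans (le_max_left _ _)⟩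

/-- Solutions of a linear equation which agree at one time are equal. -/
theorem IsLinearSolution.eq_of_eq {A : ℝ → F →L[ℝ] F} (hA : Continuous A) {u v : ℝ → F}
    (hu : IsLinearSolution A u) (hv : IsLinearSolution A v) {t₀ : ℝ} (h : u t₀ = v t₀) :
    u = v := by
  funext t
  -- The coefficients are only locally bounded, so uniqueness is applied on a bounded interval
  -- containing both times in its interior.
  obtain ⟨K, hK0, hK⟩ := exists_bound_Icc hA (-(|t₀| + |t| + 1)) (|t₀| + |t| + 1)
  have h1 := abs_le.1 (le_refl |t|)
  have h2 := abs_le.1 (le_refl |t₀|)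
  have h3 := abs_nonneg t
  have h4 := abs_nonneg t₀
  refine ODE_solution_unique_of_mem_Ioo (v := fun t x => A t x) (s := fun _ => univ)
    (K := K.toNNReal) (a := -(|t₀| + |t| + 1)) (b := |t₀| + |t| + 1) ?_
    (t₀ := t₀) ⟨by linarith, by linarith⟩ (fun t _ => ⟨hu t, mem_univ _⟩)
    (fun t _ => ⟨hv t, mem_univ _⟩) h ⟨by linarith, by linarith⟩
  intro t ht
  refine ((A t).lipschitz.weaken ?_).lipschitzOnWith
  rw [← NNReal.coe_le_coe, Real.coe_toNNReal _ hK0]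
  exact hK t (Ioo_subset_Icc_self ht)

/-- The terms of the Dyson series of `u' = A(t) u`, `u(0) = v`. -/
noncomputable def dysonTerm (A : ℝ → F →L[ℝ] F) (v : F) : ℕ → ℝ → F
  | 0 => fun _ => v
  | n + 1 => fun t => ∫ s in (0 : ℝ)..t, A s (dysonTerm A v n s)

theorem continuous_dysonTerm [CompleteSpace F] {A : ℝ → F →L[ℝ] F} (hA : Continuous A) (v : F)
    (n : ℕ) : Continuous (dysonTerm A v n) := by
  induction n with
  | zero => exact continuous_const
  | succ n ih =>
    exact intervalIntegral.continuous_primitive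
      (fun a b => (hA.clm_apply ih).intervalIntegrable a b) 0

theorem hasDerivAt_dysonTerm [CompleteSpace F] {A : ℝ → F →L[ℝ] F} (hA : Continuous A) (v : F)
    (n : ℕ) (t : ℝ) : HasDerivAt (dysonTerm A v (n + 1)) (A t (dysonTerm A v n t)) t :=
  intervalIntegral.integral_hasDerivAt_right
    ((hA.clm_apply (continuous_dysonTerm hA v n)).intervalIntegrable _ _)
    (hA.clm_apply (continuous_dysonTerm hA v n)).stronglyMeasurable.stronglyMeasurableAtFilter
    (hA.clm_apply (continuous_dysonTerm hA v n)).continuousAt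

/-- Each integration of `|s| ^ n` supplies the next factor of the factorial; the series therefore
converges uniformly on bounded intervals. -/
theorem norm_dysonTerm_le {A : ℝ → F →L[ℝ] F} (v : F) {T K : ℝ}
    (hK0 : 0 ≤ K) (hK : ∀ t ∈ Icc (-T) T, ‖A t‖ ≤ K) (n : ℕ) {t : ℝ} (ht : |t| ≤ T) :
    ‖dysonTerm A v n t‖ ≤ ‖v‖ * ((K * |t|) ^ n / n.factorial) := by
  induction n generalizing t with
  | zero => simp [dysonTerm]
  | succ n ih =>
    have hint := integral_pow_abs_sub_uIoc (a := 0) (b := t) n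
    calc ‖dysonTerm A v (n + 1) t‖
        ≤ ∫ s in uIoc 0 t, ‖v‖ * (K ^ (n + 1) / n.factorial) * |s - 0| ^ n := by
          rw [dysonTerm, intervalIntegral.norm_intervalIntegral_eq]
          apply MeasureTheory.norm_integral_le_of_norm_le
            (Continuous.integrableOn_uIoc (by fun_prop))
          refine (MeasureTheory.ae_restrict_mem measurableSet_uIoc).mono fun s hs => ?_
          have hs' : |s| ≤ |t| := by
            rcases le_total 0 t with h | h
            · rw [uIoc_of_le h] at hs
              rw [abs_of_pos hs.1, abs_of_nonneg h]; exact hs.2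
            · rw [uIoc_of_ge h] at hs
              rw [abs_of_nonpos hs.2, abs_of_nonpos h]; linarith [hs.1]
          have hsT := hs'.trans ht
          calc ‖A s (dysonTerm A v n s)‖ ≤ ‖A s‖ * ‖dysonTerm A v n s‖ := (A s).le_opNorm _
            _ ≤ K * (‖v‖ * ((K * |s|) ^ n / n.factorial)) := by
              gcongr
              · exact hK s (abs_le.1 hsT)
              · exact ih hsT
            _ = _ := by rw [sub_zero, mul_pow]; ring
      _ = ‖v‖ * ((K * |t|) ^ (n + 1) / (n + 1).factorial) := by
          rw [MeasureTheory.integral_const_mul, hint, sub_zero, Nat.factorial_succ, mul_pow]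
          push_cast
          field_simp

/-- Termwise differentiation shifts the Dyson series by one index and applies `A t`, so its sum
solves the equation. The constant term is kept apart: all the others vanish at `0`. -/
theorem exists_isLinearSolution_zero [CompleteSpace F] {A : ℝ → F →L[ℝ] F} (hA : Continuous A)
    (v : F) : ∃ u, IsLinearSolution A u ∧ u 0 = v := by
  have h0 : ∀ n, dysonTerm A v (n + 1) 0 = 0 := fun n => by simp [dysonTerm]
  have key : ∀ T > 0, (∀ t, |t| ≤ T → Summable fun n => dysonTerm A v n t) ∧
      ∀ t ∈ Ioo (-T) T, HasDerivAt (fun t => ∑' n, dysonTerm A v (n + 1) t)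
        (∑' n, A t (dysonTerm A v n t)) t := by
    intro T hT
    obtain ⟨K, hK0, hK⟩ := exists_bound_Icc hA (-T) T
    have hsum : Summable fun n : ℕ => ‖v‖ * ((K * T) ^ n / n.factorial) :=
      (Real.summable_pow_div_factorial (K * T)).mul_left _
    have hbd : ∀ n t, |t| ≤ T → ‖dysonTerm A v n t‖ ≤ ‖v‖ * ((K * T) ^ n / n.factorial) := by
      intro n t ht
      refine (norm_dysonTerm_le v hK0 hK n ht).trans ?_
      gcongr
    refine ⟨fun t ht => Summable.of_norm_bounded hsum fun n => hbd n t ht, fun t ht => ?_⟩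
    refine hasDerivAt_tsum_of_isPreconnected (hsum.mul_left K) isOpen_Ioo isPreconnected_Ioo
      (fun n y _ => hasDerivAt_dysonTerm hA v n y) (fun n y hy => ?_) (y₀ := 0)
      ⟨by linarith, hT⟩ ?_ ht
    · refine ((A y).le_opNorm _).trans ?_
      gcongr
      · exact hK y (Ioo_subset_Icc_self hy)
      · exact hbd n y (abs_le.2 (Ioo_subset_Icc_self hy))
    · simp only [h0]; exact summable_zero
  refine ⟨fun t => v + ∑' n, dysonTerm A v (n + 1) t, fun t => ?_, by simp [h0]⟩
  obtain ⟨hs, hd⟩ := key (|t| + 1) (by positivity)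
  have ht : t ∈ Ioo (-(|t| + 1)) (|t| + 1) := abs_lt.1 (by linarith)
  have hst := hs t (by linarith)
  have heq : v + ∑' n, dysonTerm A v (n + 1) t = ∑' n, dysonTerm A v n t :=
    (hst.tsum_eq_zero_add).symm
  beta_reduce
  rw [heq, (A t).map_tsum hst]
  exact (hd t ht).const_add v

/-- Global existence for linear equations with continuous coefficients. -/
theorem exists_isLinearSolution [CompleteSpace F] {A : ℝ → F →L[ℝ] F} (hA : Continuous A)
    (t₀ : ℝ) (v : F) : ∃ u, IsLinearSolution A u ∧ u t₀ = v := by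
  obtain ⟨u, hu, hu0⟩ := exists_isLinearSolution_zero (A := fun t => A (t + t₀))
    (hA.comp (continuous_add_const t₀)) v
  refine ⟨fun t => u (t + -t₀), ?_, by simpa using hu0⟩
  simpa using hu.comp_add_const (-t₀)

/-- Continuous dependence of solutions on the coefficients and on the initial value. -/
theorem IsLinearSolution.tendsto_of_tendsto {ι : Type*} {l : Filter ι} {A : ι → ℝ → F →L[ℝ] F}
    {A₀ : ℝ → F →L[ℝ] F} (hA₀ : Continuous A₀)
    (hA : ∀ T, TendstoUniformlyOn A A₀ l (Icc 0 T)) {u : ι → ℝ → F} {u₀ : ℝ → F}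
    (hu : ∀ i, IsLinearSolution (A i) (u i)) (hu₀ : IsLinearSolution A₀ u₀)
    (h : Tendsto (fun i => u i 0) l (𝓝 (u₀ 0))) {t : ℝ} (ht : 0 ≤ t) :
    Tendsto (fun i => u i t) l (𝓝 (u₀ t)) := by
  obtain ⟨K, hK0, hK⟩ := exists_bound_Icc hA₀ 0 t
  obtain ⟨C, hC⟩ := isCompact_Icc.exists_bound_of_continuousOn
    (hu₀.continuous.continuousOn (s := Icc 0 t))
  have hC0 : 0 ≤ C := (norm_nonneg _).trans (hC 0 ⟨le_rfl, ht⟩)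
  -- The difference of the two solutions will satisfy a Grönwall inequality with initial error `η`,
  -- rate `K + 1` and forcing `η * C`; its bound at time `t` vanishes with `η`.
  have hlim : Tendsto (fun η => gronwallBound η (K + 1) (η * C) t) (𝓝[>] 0) (𝓝 0) := by
    have hc : Continuous fun η => gronwallBound η (K + 1) (η * C) t := by
      simp only [gronwallBound_of_K_ne_0 (by positivity : K + 1 ≠ 0)]
      fun_prop
    have := hc.tendsto 0
    simp only [zero_mul, gronwallBound_ε0_δ0] at this
    exact this.mono_left nhdsWithin_le_nhds
  rw [Metric.tendsto_nhds]
  intro ε hε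
  obtain ⟨η, hη, hη0, hη1⟩ := ((hlim.eventually (gt_mem_nhds hε)).and
    (Ioo_mem_nhdsGT (zero_lt_one' ℝ))).exists
  filter_upwards [Metric.tendstoUniformlyOn_iff.1 (hA t) η hη0,
    (Metric.tendsto_nhds.1 h) η hη0] with i hi hi0
  have hw := (fun s => ((hu i s).sub (hu₀ s)))
  have := norm_le_gronwallBound_of_norm_deriv_right_le (f := fun s => u i s - u₀ s) (δ := η)
    (f' := fun s => A i s (u i s) - A₀ s (u₀ s)) (K := K + 1) (ε := η * C) (a := 0) (b := t)
    (((hu i).continuous.sub hu₀.continuous).continuousOn)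
    (fun s _ => (hw s).hasDerivWithinAt) (by rw [← dist_eq_norm]; exact hi0.le) ?_ t ⟨ht, le_rfl⟩
  · rw [sub_zero, ← dist_eq_norm] at this
    exact this.trans_lt hη
  · intro s hs
    have hs' := Ico_subset_Icc_self hs
    have h1 : ‖A i s - A₀ s‖ < η := by rw [← dist_eq_norm']; exact hi s hs'
    have h2 : ‖A i s‖ ≤ K + 1 := by
      have := norm_le_norm_add_norm_sub' (A i s) (A₀ s)
      linarith [hK s hs']
    have h3 : A i s (u i s) - A₀ s (u₀ s) = A i s (u i s - u₀ s) + (A i s - A₀ s) (u₀ s) := by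
      simp
    rw [h3]
    refine (norm_add_le _ _).trans (add_le_add ?_ ?_)
    · exact ((A i s).le_opNorm _).trans (by gcongr)
    · refine ((A i s - A₀ s).le_opNorm _).trans ?_
      gcongr
      exact hC s hs'

/-- The evolution operator from time `0` to time `t` of a linear equation. -/
theorem exists_evolution [CompleteSpace F] {A : ℝ → F →L[ℝ] F} (hA : Continuous A) :
    ∃ Φ : ℝ → F →ₗ[ℝ] F, (∀ v, IsLinearSolution A fun t => Φ t v) ∧ (∀ v, Φ 0 v = v) ∧
      ∀ t, Function.Injective (Φ t) := by
  choose u hu hu0 using exists_isLinearSolution hA 0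
  refine ⟨fun t => ⟨⟨fun v => u v t, fun v w => ?_⟩, fun c v => ?_⟩, hu, hu0, fun t v w h => ?_⟩
  · exact congrFun ((hu (v + w)).eq_of_eq hA ((hu v).add (hu w)) (t₀ := 0) (by simp [hu0])) t
  · exact congrFun ((hu (c • v)).eq_of_eq hA ((hu v).const_smul c) (t₀ := 0) (by simp [hu0])) t
  · have := (hu v).eq_of_eq hA (hu w) (t₀ := t) h
    rw [← hu0 v, ← hu0 w, this]

end LinearODE

/-! ### Quadratic forms increasing along solutions. -/

section MonotoneForm

variable {F : Type*} [NormedAddCommGroup F] [NormedSpace ℝ F]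

theorem IsLinearSolution.hasDerivAt_form {A : ℝ → F →L[ℝ] F} {u : ℝ → F}
    (hu : IsLinearSolution A u) {B : F →L[ℝ] F →L[ℝ] ℝ} (hsymm : ∀ v w, B v w = B w v) (t : ℝ) :
    HasDerivAt (fun t => B (u t) (u t)) (2 * B (A t (u t)) (u t)) t := by
  have := (B.hasFDerivAt.comp_hasDerivAt t (hu t)).clm_apply (hu t)
  convert! this using 1
  simp only [Function.comp_apply]
  rw [hsymm (u t)]; ring

/-- Along solutions, a form whose derivative is positive definite is monotone. -/
theorem IsLinearSolution.monotoneOn_form {A : ℝ → F →L[ℝ] F} {u : ℝ → F}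
    (hu : IsLinearSolution A u) {B : F →L[ℝ] F →L[ℝ] ℝ} (hsymm : ∀ v w, B v w = B w v)
    {c T : ℝ} (hc : 0 < c) (hB : ∀ t, T ≤ t → ∀ v, c * ‖v‖ ^ 2 ≤ B (A t v) v) :
    MonotoneOn (fun t => B (u t) (u t)) (Ici T) := by
  refine monotoneOn_of_deriv_nonneg (convex_Ici T)
    (fun t _ => (hu.hasDerivAt_form hsymm t).continuousAt.continuousWithinAt)
    (fun t _ => (hu.hasDerivAt_form hsymm t).differentiableAt.differentiableWithinAt)
    fun t ht => ?_
  rw [(hu.hasDerivAt_form hsymm t).deriv]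
  have h1 := hB t (interior_subset ht) (u t)
  have h2 : 0 ≤ c * ‖u t‖ ^ 2 := by positivity
  linarith

/-- The form is nondecreasing along `u` and tends to `0`, so it never exceeds its limit. -/
theorem IsLinearSolution.form_nonpos_of_tendsto_zero {A : ℝ → F →L[ℝ] F} {u : ℝ → F}
    (hu : IsLinearSolution A u) {B : F →L[ℝ] F →L[ℝ] ℝ} (hsymm : ∀ v w, B v w = B w v)
    {c T : ℝ} (hc : 0 < c) (hB : ∀ t, T ≤ t → ∀ v, c * ‖v‖ ^ 2 ≤ B (A t v) v)
    (h0 : Tendsto u atTop (𝓝 0)) {t : ℝ} (ht : T ≤ t) : B (u t) (u t) ≤ 0 := by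
  have hcont : Continuous fun v => B v v := by fun_prop
  have hlim : Tendsto (fun t => B (u t) (u t)) atTop (𝓝 0) := by
    simpa [Function.comp_def] using (hcont.tendsto 0).comp h0
  refine ge_of_tendsto hlim ?_
  filter_upwards [eventually_ge_atTop t] with s hs
  exact hu.monotoneOn_form hsymm hc hB ht (ht.trans hs) hs

/-- Monotonicity and the limit `0` squeeze the form to `0` on all of `[T, ∞)`. Its derivative at `T`
then vanishes, and strict positivity of that derivative forces `u T = 0`. -/
theorem IsLinearSolution.eq_zero_of_form_eq_zero {A : ℝ → F →L[ℝ] F} {u : ℝ → F}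
    (hu : IsLinearSolution A u) {B : F →L[ℝ] F →L[ℝ] ℝ} (hsymm : ∀ v w, B v w = B w v)
    {c T : ℝ} (hc : 0 < c) (hB : ∀ t, T ≤ t → ∀ v, c * ‖v‖ ^ 2 ≤ B (A t v) v)
    (h0 : Tendsto u atTop (𝓝 0)) (hT : 0 ≤ B (u T) (u T)) : u T = 0 := by
  have hzero : ∀ t ∈ Ici T, B (u t) (u t) = 0 := fun t ht =>
    le_antisymm (hu.form_nonpos_of_tendsto_zero hsymm hc hB h0 ht)
      (hT.trans (hu.monotoneOn_form hsymm hc hB self_mem_Ici ht ht))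
  have hd : HasDerivWithinAt (fun t => B (u t) (u t)) 0 (Ici T) T :=
    (hasDerivWithinAt_const T (Ici T) (0 : ℝ)).congr hzero (hzero T self_mem_Ici)
  have h := (uniqueDiffOn_Ici T T self_mem_Ici).eq_deriv _
    (hu.hasDerivAt_form hsymm T).hasDerivWithinAt hd
  have h1 := hB T le_rfl (u T)
  have h2 : ‖u T‖ ^ 2 ≤ 0 := by
    by_contra! h3
    have := mul_pos hc h3
    linarith
  simpa using h2

/-- An autonomous system with a strictly monotone form has no nonzero solution which decays at both
ends. -/
theorem IsLinearSolution.eq_zero_of_tendsto_zero_of_const {A : F →L[ℝ] F} {u : ℝ → F}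
    (hu : IsLinearSolution (fun _ => A) u) {B : F →L[ℝ] F →L[ℝ] ℝ}
    (hsymm : ∀ v w, B v w = B w v) {c : ℝ} (hc : 0 < c) (hB : ∀ v, c * ‖v‖ ^ 2 ≤ B (A v) v)
    (htop : Tendsto u atTop (𝓝 0)) (hbot : Tendsto u atBot (𝓝 0)) : u 0 = 0 := by
  refine hu.eq_zero_of_form_eq_zero hsymm hc (fun _ _ => hB) htop ?_
  -- Time reversal replaces `A` by `-A`; replacing `B` by `-B` as well preserves the positivity
  -- inequality.
  have := hu.comp_neg.form_nonpos_of_tendsto_zero (B := -B) (T := 0)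
    (fun v w => by simp [hsymm v w]) hc (fun _ _ v => by simpa using hB v)
    (hbot.comp tendsto_neg_atTop_atBot) le_rfl
  simpa using this

/-- The initial values at time `0` of the solutions of `u' = A(t) u` which decay at `+∞`. -/
def stableSpace (A : ℝ → F →L[ℝ] F) : Submodule ℝ F where
  carrier := {v | ∃ u, IsLinearSolution A u ∧ u 0 = v ∧ Tendsto u atTop (𝓝 0)}
  zero_mem' := ⟨fun _ => 0, .zero A, rfl, tendsto_const_nhds⟩
  add_mem' := by
    rintro v w ⟨u, hu, rfl, hu0⟩ ⟨u', hu', rfl, hu0'⟩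
    exact ⟨_, hu.add hu', rfl, by simpa using hu0.add hu0'⟩
  smul_mem' := by
    rintro c v ⟨u, hu, rfl, hu0⟩
    exact ⟨_, hu.const_smul c, rfl, by simpa using hu0.const_smul c⟩

end MonotoneForm

/-! ### Exponential decay, and limits of subspaces. -/

section Euclidean

variable {E : Type*} [NormedAddCommGroup E] [InnerProductSpace ℝ E]

/-- A solution on which a form with positive definite derivative stays nonpositive decays. -/
theorem IsLinearSolution.tendsto_zero_of_form_nonpos {A : ℝ → E →L[ℝ] E} {u : ℝ → E}
    (hu : IsLinearSolution A u) {B : E →L[ℝ] E →L[ℝ] ℝ} (hsymm : ∀ v w, B v w = B w v)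
    {c T K : ℝ} (hc : 0 < c) (hB : ∀ t, T ≤ t → ∀ v, c * ‖v‖ ^ 2 ≤ B (A t v) v)
    (hK : ∀ t, T ≤ t → ‖A t‖ ≤ K) (hnonpos : ∀ t, T ≤ t → B (u t) (u t) ≤ 0) :
    Tendsto u atTop (𝓝 0) := by
  have hK0 : 0 ≤ K := (norm_nonneg _).trans (hK T le_rfl)
  -- Since `B ≤ 0` late, `g = ε ‖u‖² - B` dominates `ε ‖u‖²`. The term `ε ‖u‖²` grows at rate at
  -- most `c ‖u‖²` by the choice of `ε`, while `-B` falls at rate at least `2 c ‖u‖²`. Hence `g' ≤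
  -- -c ‖u‖² ≤ -β g`.
  set ε := c / (2 * (K + 1)) with hε
  have hεpos : 0 < ε := by positivity
  have hεK : ε * K ≤ c / 2 := by
    rw [hε, div_mul_eq_mul_div, div_le_div_iff₀ (by positivity) (by positivity)]
    nlinarith
  set β := c / (‖B‖ + ε) with hβ
  have hβpos : 0 < β := by positivity
  set g := fun t => ε * ‖u t‖ ^ 2 - B (u t) (u t) with hg
  have hgd : ∀ t, HasDerivAt g
      (ε * (2 * inner ℝ (u t) (A t (u t))) - 2 * B (A t (u t)) (u t)) t := fun t =>
    ((hu t).norm_sq.const_mul ε).sub (hu.hasDerivAt_form hsymm t)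
  have hgle : ∀ t, g t ≤ (‖B‖ + ε) * ‖u t‖ ^ 2 := fun t => by
    have h1 : ‖B (u t) (u t)‖ ≤ ‖B‖ * ‖u t‖ * ‖u t‖ := B.le_opNorm₂ _ _
    have h2 := (abs_le.1 h1).1
    simp only [hg]; nlinarith
  have hd' : ∀ t, HasDerivAt (fun t => g t * Real.exp (β * t))
      ((ε * (2 * inner ℝ (u t) (A t (u t))) - 2 * B (A t (u t)) (u t)) * Real.exp (β * t) +
        g t * (Real.exp (β * t) * (β * 1))) t := fun t =>
    (hgd t).mul (((hasDerivAt_id t).const_mul β).exp)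
  have hanti : AntitoneOn (fun t => g t * Real.exp (β * t)) (Ici T) := by
    refine antitoneOn_of_deriv_nonpos (convex_Ici T)
      (fun t _ => (hd' t).continuousAt.continuousWithinAt)
      (fun t _ => (hd' t).differentiableAt.differentiableWithinAt) fun t ht => ?_
    have htT : T ≤ t := interior_subset ht
    rw [(hd' t).deriv]
    have h1 : inner ℝ (u t) (A t (u t)) ≤ K * ‖u t‖ ^ 2 := by
      refine (real_inner_le_norm _ _).trans ?_
      have := (A t).le_of_opNorm_le (hK t htT) (u t)
      nlinarith [norm_nonneg (u t)]
    have h2 := hB t htT (u t)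
    have h3 : β * g t ≤ c * ‖u t‖ ^ 2 := by
      calc β * g t ≤ β * ((‖B‖ + ε) * ‖u t‖ ^ 2) := by gcongr; exact hgle t
        _ = c * ‖u t‖ ^ 2 := by rw [hβ]; field_simp
    have h4 : ε * inner ℝ (u t) (A t (u t)) ≤ c / 2 * ‖u t‖ ^ 2 :=
      calc ε * inner ℝ (u t) (A t (u t)) ≤ ε * (K * ‖u t‖ ^ 2) := by gcongr
        _ = ε * K * ‖u t‖ ^ 2 := by ring
        _ ≤ _ := by gcongr
    have h5 : (ε * (2 * inner ℝ (u t) (A t (u t))) - 2 * B (A t (u t)) (u t)) + β * g t ≤ 0 := by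
      linarith
    have := mul_nonpos_of_nonpos_of_nonneg h5 (Real.exp_pos (β * t)).le
    linarith
  have hbound : ∀ t, T ≤ t → ‖u t‖ ^ 2 ≤ g T * Real.exp (β * T) / ε * Real.exp (-(β * t)) := by
    intro t ht
    have h1 : g t * Real.exp (β * t) ≤ g T * Real.exp (β * T) := hanti self_mem_Ici ht ht
    have h2 : ε * ‖u t‖ ^ 2 ≤ g t := by
      have := hnonpos t ht
      simp only [hg]; linarith
    rw [Real.exp_neg, ← div_eq_mul_inv, div_div, le_div_iff₀ (by positivity)]
    refine le_trans ?_ h1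
    calc ‖u t‖ ^ 2 * (ε * Real.exp (β * t)) = ε * ‖u t‖ ^ 2 * Real.exp (β * t) := by ring
      _ ≤ _ := by gcongr
  have hexp : Tendsto (fun t => g T * Real.exp (β * T) / ε * Real.exp (-(β * t))) atTop (𝓝 0) := by
    have := (Real.tendsto_exp_neg_atTop_nhds_zero.comp
      (tendsto_id.const_mul_atTop hβpos)).const_mul (g T * Real.exp (β * T) / ε)
    simpa [Function.comp_def] using this
  have hsq : Tendsto (fun t => ‖u t‖ ^ 2) atTop (𝓝 0) :=
    tendsto_of_tendsto_of_tendsto_of_le_of_le' tendsto_const_nhds hexp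
      (Eventually.of_forall fun t => by positivity)
      ((eventually_ge_atTop T).mono hbound)
  rw [tendsto_zero_iff_norm_tendsto_zero]
  have := hsq.sqrt
  simpa [Real.sqrt_sq] using this

variable [FiniteDimensional ℝ E]

/-- On a vector of `V` killed by `Q` the difference acts as the identity, which an operator of norm
below one allows only for `0`. -/
theorem starProjection_injOn_of_norm_sub_lt {V : Submodule ℝ E} {Q : E →L[ℝ] E}
    (h : ‖V.starProjection - Q‖ < 1) : ∀ v ∈ V, Q v = 0 → v = 0 := by
  intro v hv hQ
  by_contra hne
  have h1 : (V.starProjection - Q) v = v := by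
    simp [hQ, Submodule.starProjection_eq_self_iff.2 hv]
  have h2 := (V.starProjection - Q).le_opNorm v
  rw [h1] at h2
  have := norm_pos_iff.2 hne
  nlinarith

/-- If all limits of vectors of the subspaces `F i` of dimension `d` lie in `G`, then `G` has
dimension at least `d`, and `F i` converges to `G` for the gap metric if `G` has dimension `d`. -/
theorem tendsto_starProjection_of_limits_mem {ι : Type*} {l : Filter ι} {V : ι → Submodule ℝ E}
    {G : Submodule ℝ E} {d : ℕ} (hd : ∀ i, Module.finrank ℝ (V i) = d)
    (hG : ∀ (U : Ultrafilter ι), ↑U ≤ l → ∀ (v : ι → E) (w : E), (∀ i, v i ∈ V i) →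
      Tendsto v U (𝓝 w) → w ∈ G) :
    (l.NeBot → d ≤ Module.finrank ℝ G) ∧
      (Module.finrank ℝ G = d → Tendsto (fun i => (V i).starProjection) l
        (𝓝 G.starProjection)) := by
  -- Projections lie in the compact unit ball of operators, so they converge along each ultrafilter.
  -- The limit is again an orthogonal projection; it has rank at least `d` because it is injective
  -- on a nearby `V i`. Equality of dimensions then leaves only the projection onto `G`.
  have key : ∀ U : Ultrafilter ι, ↑U ≤ l → ∃ Q : E →L[ℝ] E,
      Tendsto (fun i => (V i).starProjection) U (𝓝 Q) ∧ d ≤ Module.finrank ℝ Q.range ∧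
        Q.range ≤ G ∧ IsStarProjection Q := by
    intro U hU
    obtain ⟨Q, -, hQ⟩ := (isCompact_closedBall (0 : E →L[ℝ] E) 1).ultrafilter_le_nhds
      (U.map fun i => (V i).starProjection) (by
        rw [le_principal_iff, Ultrafilter.mem_coe, Ultrafilter.mem_map]
        exact univ_mem' fun i => by simpa using Submodule.starProjection_norm_le (V i))
    have hQ' : Tendsto (fun i => (V i).starProjection) U (𝓝 Q) := hQ
    refine ⟨Q, hQ', ?_, ?_, ?_, ?_⟩
    · obtain ⟨i, hi⟩ := ((tendsto_iff_norm_sub_tendsto_zero.1 hQ').eventually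
        (gt_mem_nhds one_pos)).exists
      rw [← hd i]
      refine LinearMap.finrank_le_finrank_of_injective
        (f := (Q.toLinearMap.rangeRestrict).comp (V i).subtype) ?_
      rw [← LinearMap.ker_eq_bot, LinearMap.ker_eq_bot']
      rintro ⟨v, hv⟩ h
      have hv0 := starProjection_injOn_of_norm_sub_lt hi v hv (by simpa [Subtype.ext_iff] using h)
      simpa using hv0
    · rintro _ ⟨v, rfl⟩
      exact hG U hU (fun i => (V i).starProjection v) _
        (fun i => Submodule.starProjection_apply_mem _ _)
        (((ContinuousLinearMap.apply ℝ E v).continuous.tendsto Q).comp hQ')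
    · refine tendsto_nhds_unique (hQ'.mul hQ') (hQ'.congr fun i => ?_)
      exact ((V i).isIdempotentElem_starProjection).eq.symm
    · refine tendsto_nhds_unique hQ'.star (hQ'.congr fun i => ?_)
      exact (isSelfAdjoint_starProjection (V i)).symm
  constructor
  · intro hl
    obtain ⟨Q, -, h1, h2, -⟩ := key (Ultrafilter.of l) (Ultrafilter.of_le l)
    exact h1.trans (Submodule.finrank_mono h2)
  · intro hGd
    rw [tendsto_iff_ultrafilter]
    intro U hU
    obtain ⟨Q, hQ, h1, h2, h3⟩ := key U hU
    have hr : Q.range = G := Submodule.eq_of_le_of_finrank_le h2 (hGd ▸ h1)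
    obtain ⟨_, h4⟩ := isStarProjection_iff_eq_starProjection_range.1 h3
    have h5 : Q = G.starProjection := by rw [h4]; congr
    rwa [← h5]

end Euclidean

/-! ### Dimension and continuity of stable spaces. -/

section StableSpace

variable {E : Type*} [NormedAddCommGroup E] [InnerProductSpace ℝ E]

/-- Replaces decay, an asymptotic condition, by closed conditions at individual times, which survive
passage to the limit. -/
theorem mem_stableSpace_of_form_nonpos {A : ℝ → E →L[ℝ] E} (hA : Continuous A)
    {B : E →L[ℝ] E →L[ℝ] ℝ} (hsymm : ∀ v w, B v w = B w v) {c T K : ℝ} (hc : 0 < c)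
    (hB : ∀ t, T ≤ t → ∀ v, c * ‖v‖ ^ 2 ≤ B (A t v) v) (hK : ∀ t, T ≤ t → ‖A t‖ ≤ K)
    {Φ : ℝ → E →ₗ[ℝ] E} (hΦ : ∀ v, IsLinearSolution A fun t => Φ t v) (hΦ0 : ∀ v, Φ 0 v = v)
    {v : E} : v ∈ stableSpace A ↔ ∀ t, T ≤ t → B (Φ t v) (Φ t v) ≤ 0 := by
  constructor
  · rintro ⟨u, hu, rfl, hu0⟩ t ht
    have : (fun t => Φ t (u 0)) = u := (hΦ _).eq_of_eq hA hu (t₀ := 0) (hΦ0 _)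
    rw [congrFun this t]
    exact hu.form_nonpos_of_tendsto_zero hsymm hc hB hu0 ht
  · intro h
    exact ⟨_, hΦ v, hΦ0 v, (hΦ v).tendsto_zero_of_form_nonpos hsymm hc hB hK h⟩

variable [FiniteDimensional ℝ E]

/-- The dimension of the stable space is the negative index of a form with positive definite
derivative. -/
theorem finrank_stableSpace {A : ℝ → E →L[ℝ] E} (hA : Continuous A)
    {B : E →L[ℝ] E →L[ℝ] ℝ} (hsymm : ∀ v w, B v w = B w v) {c T K : ℝ} (hc : 0 < c)
    (hB : ∀ t, T ≤ t → ∀ v, c * ‖v‖ ^ 2 ≤ B (A t v) v) (hK : ∀ t, T ≤ t → ‖A t‖ ≤ K)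
    {N P : Submodule ℝ E} (hN : ∀ v ∈ N, B v v ≤ 0) (hP : ∀ v ∈ P, 0 ≤ B v v)
    (hNP : Module.finrank ℝ N + Module.finrank ℝ P = Module.finrank ℝ E) :
    Module.finrank ℝ (stableSpace A) = Module.finrank ℝ N := by
  obtain ⟨Φ, hΦ, hΦ0, hinj⟩ := exists_evolution hA
  apply le_antisymm
  -- Upper bound: a stable vector transported to time `T` that lies in `P` has `B ≥ 0` there, hence
  -- vanishes.
  · have hdisj : Disjoint ((stableSpace A).map (Φ T)) P := by
      rw [Submodule.disjoint_def]
      rintro _ ⟨v, ⟨u, hu, rfl, hu0⟩, rfl⟩ hw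
      have : (fun t => Φ t (u 0)) = u := (hΦ _).eq_of_eq hA hu (t₀ := 0) (hΦ0 _)
      have hT : Φ T (u 0) = u T := congrFun this T
      rw [hT] at hw ⊢
      exact hu.eq_zero_of_form_eq_zero hsymm hc hB hu0 (hP _ hw)
    have h1 := Submodule.finrank_add_finrank_le_of_disjoint hdisj
    rw [← (Submodule.equivMapOfInjective (Φ T) (hinj T) (stableSpace A)).finrank_eq] at h1
    omega
  -- Lower bound: pull `N` back from time `s` to time `0`. By monotonicity such vectors have `B ≤ 0`
  -- on `[T, s]`, so their limits as `s → ∞` are stable.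
  · refine (tendsto_starProjection_of_limits_mem (l := atTop) (V := fun s => N.comap (Φ s))
      (fun s => ?_) ?_).1 inferInstance
    · have h2 : N = (N.comap (Φ s)).map (Φ s) :=
        (Submodule.map_comap_eq_of_surjective
          (LinearMap.injective_iff_surjective.1 (hinj s)) N).symm
      conv_rhs => rw [h2]
      exact (Submodule.equivMapOfInjective (Φ s) (hinj s) _).finrank_eq
    · intro U hU v w hv hvw
      rw [mem_stableSpace_of_form_nonpos hA hsymm hc hB hK hΦ hΦ0]
      intro t ht
      have hcont : Continuous fun v => B (Φ t v) (Φ t v) := by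
        have := (Φ t).continuous_of_finiteDimensional
        fun_prop
      refine le_of_tendsto ((hcont.tendsto w).comp hvw) ?_
      filter_upwards [hU (eventually_ge_atTop t)] with s hs
      exact ((hΦ (v s)).monotoneOn_form hsymm hc hB ht (ht.trans hs) hs).trans (hN _ (hv s))

/-- Stable spaces of constant dimension depend continuously on the coefficients. -/
theorem continuousAt_stableSpace {X : Type*} [TopologicalSpace X] {A : X → ℝ → E →L[ℝ] E}
    (hA : Continuous fun p : X × ℝ => A p.1 p.2) {d : ℕ}
    (hd : ∀ x, Module.finrank ℝ (stableSpace (A x)) = d) {x₀ : X}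
    {B : E →L[ℝ] E →L[ℝ] ℝ} (hsymm : ∀ v w, B v w = B w v) {c T K : ℝ} (hc : 0 < c) (hT : 0 ≤ T)
    (hB : ∀ᶠ x in 𝓝 x₀, ∀ t, T ≤ t → ∀ v, c * ‖v‖ ^ 2 ≤ B (A x t v) v)
    (hK : ∀ᶠ x in 𝓝 x₀, ∀ t, T ≤ t → ‖A x t‖ ≤ K) :
    ContinuousAt (fun x => (stableSpace (A x)).starProjection) x₀ := by
  have hAx : ∀ x, Continuous (A x) := fun x => hA.comp (Continuous.prodMk_right x)
  have hunif : ∀ T, TendstoUniformlyOn A (A x₀) (𝓝 x₀) (Icc 0 T) := by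
    intro T u hu
    obtain ⟨V, hV, h⟩ := isCompact_Icc.mem_uniformity_of_prod (f := A) (s := univ) (q := x₀)
      (k := Icc 0 T) hA.continuousOn (mem_univ _) (symm_le_uniformity hu)
    rw [nhdsWithin_univ] at hV
    filter_upwards [hV] with x hx t ht using h x hx t ht
  choose Φ hΦ hΦ0 hinj using fun x => exists_evolution (hAx x)
  -- At each fixed `t ≥ T` the inequality `B ≤ 0` passes to the limit by continuous dependence;
  -- constancy of the dimension does the rest.
  refine (tendsto_starProjection_of_limits_mem hd fun U hU v w hv hvw => ?_).2 (hd x₀)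
  rw [mem_stableSpace_of_form_nonpos (hAx x₀) hsymm hc hB.self_of_nhds hK.self_of_nhds
    (hΦ x₀) (hΦ0 x₀)]
  intro t ht
  have hlim : Tendsto (fun x => Φ x t (v x)) U (𝓝 (Φ x₀ t w)) :=
    IsLinearSolution.tendsto_of_tendsto (hAx x₀) (fun T u hu => hU (hunif T u hu))
      (fun x => hΦ x (v x)) (hΦ x₀ w) (by simpa [hΦ0] using hvw) (hT.trans ht)
  have hcont : Continuous fun v => B v v := by fun_prop
  refine le_of_tendsto ((hcont.tendsto _).comp hlim) ?_
  filter_upwards [hU hB, hU hK] with x hx hx'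
  exact (mem_stableSpace_of_form_nonpos (hAx x) hsymm hc hx hx' (hΦ x) (hΦ0 x)).1 (hv x) t ht

end StableSpace

/-! ### Monotone forms and spectral subspaces of complex operators. -/

section ComplexSystem

/-- Take an eigenvector of the transpose. If `μ` were not an eigenvalue of `A`, then `A - μ` would
be onto; but `φ` vanishes on its range. The kernel of `φ` is the invariant hyperplane on which the
induction below runs. -/
theorem exists_eigenvalue_dual {V : Type*} [AddCommGroup V] [Module ℂ V] [FiniteDimensional ℂ V]
    [Nontrivial V] (A : Module.End ℂ V) :
    ∃ μ, A.HasEigenvalue μ ∧ ∃ φ : V →ₗ[ℂ] ℂ, φ ≠ 0 ∧ ∀ v, φ (A v) = μ * φ v := by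
  obtain ⟨μ, hμ⟩ := Module.End.exists_eigenvalue (K := ℂ) (A.dualMap : Module.End ℂ (Module.Dual ℂ V))
  obtain ⟨φ, hφ⟩ := hμ.exists_hasEigenvector
  have hφA : ∀ v, φ (A v) = μ * φ v := fun v => by
    simpa using LinearMap.congr_fun hφ.apply_eq_smul v
  refine ⟨μ, ?_, φ, hφ.2, hφA⟩
  rw [Module.End.hasEigenvalue_iff, Module.End.eigenspace_def]
  intro hker
  refine hφ.2 (LinearMap.ext fun v => ?_)
  obtain ⟨w, rfl⟩ := LinearMap.injective_iff_surjective.1 (LinearMap.ker_eq_bot.1 hker) v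
  simp [hφA]

/-- An operator without purely imaginary eigenvalues has a form whose derivative along the flow is
positive definite. -/
theorem exists_form_of_re_eigenvalue_ne_zero {V : Type*} [NormedAddCommGroup V] [NormedSpace ℂ V]
    [FiniteDimensional ℂ V] (A : Module.End ℂ V) (hA : ∀ μ, A.HasEigenvalue μ → μ.re ≠ 0) :
    ∃ B : V →L[ℝ] V →L[ℝ] ℝ, (∀ v w, B v w = B w v) ∧ ∃ c > 0, ∀ v, c * ‖v‖ ^ 2 ≤ B (A v) v := by
  induction hd : Module.finrank ℂ V using Nat.strong_induction_on generalizing V with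
  | _ d ih =>
    rcases subsingleton_or_nontrivial V with hV | hV
    · exact ⟨0, fun _ _ => rfl, 1, one_pos, fun v => by simp [Subsingleton.elim v 0]⟩
    obtain ⟨μ, hμ, φ, hφ0, hφ⟩ := exists_eigenvalue_dual A
    obtain ⟨e, he⟩ : ∃ e, φ e = 1 := by
      obtain ⟨v, hv⟩ := DFunLike.ne_iff.1 hφ0
      exact ⟨(φ v)⁻¹ • v, by simpa using inv_mul_cancel₀ hv⟩
    set W := LinearMap.ker φ with hW
    have hAW : ∀ w ∈ W, A w ∈ W := fun w hw => by
      rw [LinearMap.mem_ker] at hw ⊢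
      rw [hφ, hw, mul_zero]
    have hWlt : Module.finrank ℂ W < d := hd ▸ Submodule.finrank_lt (by
      rw [hW, Ne, LinearMap.ker_eq_top]; exact hφ0)
    obtain ⟨BW, hsymm, c, hc, hBW⟩ := ih _ hWlt (V := W) (A.restrict hAW) (fun ν hν => by
      obtain ⟨w, hw⟩ := hν.exists_hasEigenvector
      refine hA ν (Module.End.hasEigenvalue_of_hasEigenvector (x := (w : V)) ⟨?_, ?_⟩)
      · rw [Module.End.mem_eigenspace_iff]
        simpa using congrArg Subtype.val hw.apply_eq_smul
      · simpa using hw.2) rfl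
    let p₀ : V →ₗ[ℂ] W := (LinearMap.id - φ.smulRight e).codRestrict W fun v => by
      simp [hW, he]
    let p : V →L[ℝ] W := (LinearMap.toContinuousLinearMap p₀).restrictScalars ℝ
    let f : V →L[ℝ] ℂ := (LinearMap.toContinuousLinearMap φ).restrictScalars ℝ
    have hp : ∀ v, (p v : V) = v - φ v • e := fun _ => rfl
    have hpA : ∀ v, p (A v) = A.restrict hAW (p v) + φ v • p (A e) := fun v => by
      apply Subtype.ext
      rw [Submodule.coe_add, Submodule.coe_smul, LinearMap.coe_restrict_apply, hp, hp, hp, map_sub,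
        map_smul, hφ, hφ, he]
      module
    set m := μ.re with hm
    have hm0 : m ≠ 0 := hA μ hμ
    set D := ‖BW‖ * ‖p (A e)‖ with hD
    have hD0 : 0 ≤ D := by positivity
    let R : V →L[ℝ] V →L[ℝ] ℝ :=
      (ContinuousLinearMap.mul ℝ ℝ).bilinearComp (Complex.reCLM.comp f) (Complex.reCLM.comp f) +
      (ContinuousLinearMap.mul ℝ ℝ).bilinearComp (Complex.imCLM.comp f) (Complex.imCLM.comp f)
    have hR : ∀ v w, R v w = (φ v).re * (φ w).re + (φ v).im * (φ w).im := fun v w => rfl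
    -- Dividing by `m` makes the contribution of `|φ|²` positive whatever the sign of `Re μ`. The
    -- part `D ^ 2 / c` absorbs, by Young's inequality, the cross term caused by `p (A e)`, leaving
    -- `c / 2 ‖p v‖² + ‖φ v‖²`. The final constant compares this with `‖v‖² ≤ 2 ‖p v‖² + 2 ‖e‖² ‖φ
    -- v‖²`.
    refine ⟨BW.bilinearComp p p + ((D ^ 2 / c + 1) / m) • R, fun v w => ?_,
      min (c / 4) (1 / (2 * (‖e‖ ^ 2 + 1))), by positivity, fun v => ?_⟩
    · have : BW (p v) (p w) + ((D ^ 2 / c + 1) / m) * R v w =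
          BW (p w) (p v) + ((D ^ 2 / c + 1) / m) * R w v := by
        rw [hsymm, hR, hR]; ring
      exact this
    · have h1 : R (A v) v = m * ‖φ v‖ ^ 2 := by
        rw [hR, hφ, ← Complex.normSq_eq_norm_sq, Complex.normSq_apply]
        simp only [Complex.mul_re, Complex.mul_im]
        ring
      have h2 : BW (p (A v)) (p v) =
          BW (A.restrict hAW (p v)) (p v) + BW (φ v • p (A e)) (p v) := by
        rw [hpA, map_add, add_apply]
      have h3 := hBW (p v)
      have h4 : -(D * ‖φ v‖ * ‖p v‖) ≤ BW (φ v • p (A e)) (p v) := by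
        have h := (abs_le.1 (BW.le_opNorm₂ (φ v • p (A e)) (p v))).1
        rw [norm_smul] at h
        calc -(D * ‖φ v‖ * ‖p v‖) = -(‖BW‖ * (‖φ v‖ * ‖p (A e)‖) * ‖p v‖) := by rw [hD]; ring
          _ ≤ _ := h
      have h5 : ‖v‖ ^ 2 ≤ 2 * ‖p v‖ ^ 2 + 2 * (‖e‖ ^ 2 * ‖φ v‖ ^ 2) := by
        have h : ‖v‖ ≤ ‖p v‖ + ‖φ v‖ * ‖e‖ := by
          have hpv : v = (p v : V) + φ v • e := by rw [hp]; abel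
          conv_lhs => rw [hpv]
          refine (norm_add_le _ _).trans ?_
          rw [norm_smul]; rfl
        have h' : ‖v‖ ^ 2 ≤ (‖p v‖ + ‖φ v‖ * ‖e‖) ^ 2 := by gcongr
        nlinarith [sq_nonneg (‖p v‖ - ‖φ v‖ * ‖e‖)]
      have h6 : D * ‖φ v‖ * ‖p v‖ ≤ c / 2 * ‖p v‖ ^ 2 + D ^ 2 / c * ‖φ v‖ ^ 2 := by
        have h : 0 ≤ (c * ‖p v‖ - D * ‖φ v‖) ^ 2 / (2 * c) + D ^ 2 / (2 * c) * ‖φ v‖ ^ 2 := by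
          positivity
        have h' : (c * ‖p v‖ - D * ‖φ v‖) ^ 2 / (2 * c) + D ^ 2 / (2 * c) * ‖φ v‖ ^ 2 =
          c / 2 * ‖p v‖ ^ 2 + D ^ 2 / c * ‖φ v‖ ^ 2 - D * ‖φ v‖ * ‖p v‖ := by
          field_simp; ring
        linarith
      have h7 : (BW.bilinearComp p p + ((D ^ 2 / c + 1) / m) • R) (A v) v =
          BW (p (A v)) (p v) + (D ^ 2 / c + 1) * ‖φ v‖ ^ 2 := by
        have : (BW.bilinearComp p p + ((D ^ 2 / c + 1) / m) • R) (A v) v =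
          BW (p (A v)) (p v) + ((D ^ 2 / c + 1) / m) * R (A v) v := rfl
        rw [this, h1]; field_simp
      rw [h7, h2]
      set k := min (c / 4) (1 / (2 * (‖e‖ ^ 2 + 1))) with hk
      have hk0 : 0 ≤ k := by positivity
      have hk1 : k ≤ c / 4 := min_le_left _ _
      have hk2 : k * (2 * ‖e‖ ^ 2) ≤ 1 := by
        calc k * (2 * ‖e‖ ^ 2) ≤ 1 / (2 * (‖e‖ ^ 2 + 1)) * (2 * ‖e‖ ^ 2) := by
              gcongr; exact min_le_right _ _
          _ ≤ 1 := by
              rw [div_mul_eq_mul_div, div_le_one (by positivity)]; linarith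
      have h8 : k * ‖v‖ ^ 2 ≤ c / 2 * ‖p v‖ ^ 2 + ‖φ v‖ ^ 2 := by
        calc k * ‖v‖ ^ 2 ≤ k * (2 * ‖p v‖ ^ 2 + 2 * (‖e‖ ^ 2 * ‖φ v‖ ^ 2)) := by gcongr
          _ = 2 * k * ‖p v‖ ^ 2 + k * (2 * ‖e‖ ^ 2) * ‖φ v‖ ^ 2 := by ring
          _ ≤ 2 * (c / 4) * ‖p v‖ ^ 2 + 1 * ‖φ v‖ ^ 2 := by gcongr
          _ = _ := by ring
      linarith

variable {V : Type*} [NormedAddCommGroup V] [NormedSpace ℂ V] [FiniteDimensional ℂ V]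

/-- A complex endomorphism as a continuous real-linear operator. -/
noncomputable def realOp (A : Module.End ℂ V) : V →L[ℝ] V :=
  (LinearMap.toContinuousLinearMap A).restrictScalars ℝ

@[simp] theorem realOp_apply (A : Module.End ℂ V) (v : V) : realOp A v = A v := rfl

theorem realOp_neg (A : Module.End ℂ V) : realOp (-A) = -realOp A := rfl

/-- The sum of the generalized eigenspaces at the points with negative real part. -/
def negSpace (A : Module.End ℂ V) : Submodule ℂ V :=
  ⨆ μ ∈ {μ : ℂ | μ.re < 0}, A.maxGenEigenspace μ

/-- The coefficients of the solutions in a generalized eigenspace. -/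
noncomputable def expPow (μ : ℂ) (j : ℕ) (t : ℝ) : ℂ :=
  Complex.exp (μ * t) * ((t : ℂ) ^ j / j.factorial)

theorem hasDerivAt_expPow_zero (μ : ℂ) (t : ℝ) :
    HasDerivAt (expPow μ 0) (μ * expPow μ 0 t) t := by
  have h : HasDerivAt (fun t : ℝ => Complex.exp (μ * t)) (Complex.exp (μ * t) * (μ * 1)) t :=
    ((Complex.ofRealCLM.hasDerivAt (x := t)).const_mul μ).cexp
  have h2 : expPow μ 0 = fun t : ℝ => Complex.exp (μ * t) := by
    funext s; simp [expPow]
  rw [h2]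
  convert h using 1
  ring

theorem hasDerivAt_expPow_succ (μ : ℂ) (j : ℕ) (t : ℝ) :
    HasDerivAt (expPow μ (j + 1)) (μ * expPow μ (j + 1) t + expPow μ j t) t := by
  have h : HasDerivAt (fun t : ℝ => Complex.exp (μ * t)) (Complex.exp (μ * t) * (μ * 1)) t :=
    ((Complex.ofRealCLM.hasDerivAt (x := t)).const_mul μ).cexp
  have h2 : HasDerivAt (fun t : ℝ => (t : ℂ) ^ (j + 1) / (j + 1).factorial)
      (((j + 1 : ℕ) : ℂ) * (t : ℂ) ^ j * 1 / (j + 1).factorial) t := by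
    simpa using ((Complex.ofRealCLM.hasDerivAt (x := t)).pow (j + 1)).div_const
      ((j + 1).factorial : ℂ)
  convert! h.mul h2 using 1
  simp only [expPow, Nat.factorial_succ]
  have : (j.factorial : ℂ) ≠ 0 := Nat.cast_ne_zero.2 j.factorial_ne_zero
  have : ((j : ℂ) + 1) ≠ 0 := Nat.cast_add_one_ne_zero j
  push_cast
  field_simp

theorem tendsto_expPow {μ : ℂ} (hμ : μ.re < 0) (j : ℕ) : Tendsto (expPow μ j) atTop (𝓝 0) := by
  rw [tendsto_zero_iff_norm_tendsto_zero]
  have h := (tendsto_rpow_mul_exp_neg_mul_atTop_nhds_zero j (-μ.re) (by linarith)).div_const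
    (j.factorial : ℝ)
  rw [zero_div] at h
  refine h.congr' ?_
  filter_upwards [eventually_ge_atTop 0] with t ht
  simp [expPow, Complex.norm_exp, abs_of_nonneg ht]
  ring

/-- On such a vector the exponential is a finite sum of `e^{μt} t^j / j!` times `N ^ j v`, and the
exponential beats the powers. -/
theorem maxGenEigenspace_le_stableSpace (A : Module.End ℂ V) {μ : ℂ} (hμ : μ.re < 0) {v : V}
    (hv : v ∈ A.maxGenEigenspace μ) : v ∈ stableSpace fun _ => realOp A := by
  obtain ⟨m, hm⟩ := (Module.End.mem_maxGenEigenspace _ _ _).1 hv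
  set N := A - μ • (1 : Module.End ℂ V) with hN
  have hAN : ∀ w, A w = μ • w + N w := fun w => by simp [hN]
  -- The term `j = m` is zero; keeping it leaves a `j = 0` term to split off even if `m = 0`.
  refine ⟨fun t => ∑ j ∈ Finset.range (m + 1), expPow μ j t • (N ^ j) v, fun t => ?_, ?_, ?_⟩
  · have h : HasDerivAt (fun t => ∑ j ∈ Finset.range (m + 1), expPow μ j t • (N ^ j) v)
        (∑ j ∈ Finset.range m, (μ * expPow μ (j + 1) t + expPow μ j t) • (N ^ (j + 1)) v +
          (μ * expPow μ 0 t) • (N ^ 0) v) t := by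
      simp only [Finset.sum_range_succ']
      exact (HasDerivAt.fun_sum fun j _ => (hasDerivAt_expPow_succ μ j t).smul_const _).add
        ((hasDerivAt_expPow_zero μ t).smul_const _)
    convert h using 1
    rw [realOp_apply, hAN]
    have h1 : N (∑ j ∈ Finset.range (m + 1), expPow μ j t • (N ^ j) v) =
        ∑ j ∈ Finset.range m, expPow μ j t • (N ^ (j + 1)) v := by
      rw [Finset.sum_range_succ, hm, smul_zero, add_zero, map_sum]
      exact Finset.sum_congr rfl fun j _ => by rw [map_smul, pow_succ', Module.End.mul_apply]
    rw [h1]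
    beta_reduce
    rw [Finset.sum_range_succ', smul_add, Finset.smul_sum]
    simp only [add_smul, mul_smul, Finset.sum_add_distrib]
    abel
  · simp [Finset.sum_range_succ', expPow]
  · have := tendsto_finsetSum (Finset.range (m + 1)) fun j _ =>
      (tendsto_expPow hμ j).smul_const ((N ^ j) v)
    simpa using this

theorem negSpace_le_stableSpace (A : Module.End ℂ V) {v : V} (hv : v ∈ negSpace A) :
    v ∈ stableSpace fun _ => realOp A := by
  refine Submodule.iSup_induction _ (motive := fun v => v ∈ stableSpace fun _ => realOp A) hv
    (fun μ x hx => ?_) (Submodule.zero_mem _) fun x y => Submodule.add_mem _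
  by_cases hμ : μ.re < 0
  · exact maxGenEigenspace_le_stableSpace A hμ (by simpa [hμ] using hx)
  · have : x = 0 := by simpa [hμ] using hx
    rw [this]; exact Submodule.zero_mem _

omit [FiniteDimensional ℂ V] in
theorem maxGenEigenspace_neg (A : Module.End ℂ V) (μ : ℂ) :
    (-A).maxGenEigenspace (-μ) = A.maxGenEigenspace μ := by
  ext v
  have h : -A - (-μ) • (1 : Module.End ℂ V) = -(A - μ • 1) := by module
  simp only [Module.End.mem_maxGenEigenspace, h]
  refine exists_congr fun k => ?_
  rcases Nat.even_or_odd k with hk | hk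
  · rw [hk.neg_pow]
  · rw [hk.neg_pow, LinearMap.neg_apply, neg_eq_zero]

omit [FiniteDimensional ℂ V] in
theorem iSup_maxGenEigenspace_pos (A : Module.End ℂ V) :
    ⨆ μ ∈ {μ : ℂ | 0 < μ.re}, A.maxGenEigenspace μ = negSpace (-A) := by
  rw [negSpace]
  refine (Equiv.neg ℂ).iSup_congr fun μ => ?_
  simp [maxGenEigenspace_neg]

/-- Generalized eigenspaces span over `ℂ`, and those on the imaginary axis are trivial by
hypothesis. -/
theorem negSpace_sup_negSpace_neg (A : Module.End ℂ V) (hA : ∀ μ, A.HasEigenvalue μ → μ.re ≠ 0) :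
    negSpace A ⊔ negSpace (-A) = ⊤ := by
  rw [eq_top_iff, ← Module.End.iSup_maxGenEigenspace_eq_top A]
  refine iSup_le fun μ => ?_
  rcases lt_trichotomy μ.re 0 with h | h | h
  · exact (le_iSup₂ (f := fun (μ : ℂ) (_ : μ ∈ {μ : ℂ | μ.re < 0}) => A.maxGenEigenspace μ) μ h
      ).trans le_sup_left
  · have hbot : A.maxGenEigenspace μ = ⊥ := by
      by_contra hne
      refine hA μ ?_ h
      exact Module.End.hasUnifEigenvalue_iff_hasUnifEigenvalue_one (k := ⊤) (by simp) |>.1 hne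
    rw [hbot]; exact bot_le
  · rw [← iSup_maxGenEigenspace_pos]
    exact (le_iSup₂ (f := fun (μ : ℂ) (_ : μ ∈ {μ : ℂ | 0 < μ.re}) => A.maxGenEigenspace μ) μ h
      ).trans le_sup_right

/-- By uniqueness, a common initial value starts a single solution of `u' = A u` that decays in both
time directions. -/
theorem disjoint_stableSpace_const {F : Type*} [NormedAddCommGroup F] [NormedSpace ℝ F]
    {A : F →L[ℝ] F} {B : F →L[ℝ] F →L[ℝ] ℝ} (hsymm : ∀ v w, B v w = B w v) {c : ℝ} (hc : 0 < c)
    (hB : ∀ v, c * ‖v‖ ^ 2 ≤ B (A v) v) :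
    Disjoint (stableSpace fun _ => A) (stableSpace fun _ => -A) := by
  rw [Submodule.disjoint_def]
  rintro _ ⟨u, hu, rfl, hu0⟩ ⟨w, hw, hwu, hw0⟩
  have hw' := hw.comp_neg
  simp only [neg_neg] at hw'
  have heq : u = fun t => w (-t) :=
    hu.eq_of_eq continuous_const hw' (t₀ := 0) (by simp [hwu])
  refine hu.eq_zero_of_tendsto_zero_of_const hsymm hc hB hu0 ?_
  rw [heq]
  exact hw0.comp tendsto_neg_atBot_atTop

/-- For the converse, split a stable `v` along the spectral decomposition: its positive component is
stable for both `A` and `-A`, hence zero. -/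
theorem mem_negSpace_iff (A : Module.End ℂ V) (hA : ∀ μ, A.HasEigenvalue μ → μ.re ≠ 0) {v : V} :
    v ∈ negSpace A ↔ v ∈ stableSpace fun _ => realOp A := by
  refine ⟨negSpace_le_stableSpace A, fun hv => ?_⟩
  obtain ⟨B, hsymm, c, hc, hB⟩ := exists_form_of_re_eigenvalue_ne_zero A hA
  obtain ⟨x, hx, y, hy, rfl⟩ := Submodule.mem_sup.1
    (negSpace_sup_negSpace_neg A hA ▸ Submodule.mem_top : v ∈ negSpace A ⊔ negSpace (-A))
  have hy1 : y ∈ stableSpace fun _ => realOp A := by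
    have := Submodule.sub_mem _ hv (negSpace_le_stableSpace A hx)
    simpa using this
  have hy2 := negSpace_le_stableSpace _ hy
  rw [realOp_neg] at hy2
  have := Submodule.disjoint_def.1
    (disjoint_stableSpace_const (A := realOp A) hsymm hc hB) y hy1 hy2
  simpa [this] using hx

end ComplexSystem

/-! ### Descent to real matrices. -/

section RealMatrices

variable {n : ℕ}

/-- The operator of a real matrix on Euclidean space, as a continuous linear function of the
matrix. -/
noncomputable def matOp : Matrix (Fin n) (Fin n) ℝ →ₗ[ℝ]
    EuclideanSpace ℝ (Fin n) →L[ℝ] EuclideanSpace ℝ (Fin n) :=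
  LinearMap.toContinuousLinearMap.toLinearMap ∘ₗ Matrix.toEuclideanLin.toLinearMap

@[simp] theorem matOp_apply (A : Matrix (Fin n) (Fin n) ℝ) (v : EuclideanSpace ℝ (Fin n)) :
    matOp A v = Matrix.toEuclideanLin A v := rfl

/-- The complexification of a real matrix, as an endomorphism. -/
noncomputable def complexOp (A : Matrix (Fin n) (Fin n) ℝ) : Module.End ℂ (Fin n → ℂ) :=
  Matrix.toLin' (A.map fun x : ℝ => (x : ℂ))

theorem complexOp_neg (A : Matrix (Fin n) (Fin n) ℝ) : complexOp (-A) = -complexOp A := by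
  rw [complexOp, complexOp, ← map_neg]
  congr 1
  ext i j
  simp

/-- The inclusion of real vectors into complex vectors. -/
noncomputable def complexify : EuclideanSpace ℝ (Fin n) →L[ℝ] (Fin n → ℂ) :=
  LinearMap.toContinuousLinearMap
    { toFun := fun v i => ((v i : ℝ) : ℂ)
      map_add' := fun v w => by ext i; simp
      map_smul' := fun c v => by ext i; simp }

/-- The real part of a complex vector. -/
noncomputable def realPart : (Fin n → ℂ) →L[ℝ] EuclideanSpace ℝ (Fin n) :=
  LinearMap.toContinuousLinearMap
    { toFun := fun z => WithLp.toLp 2 fun i => (z i).re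
      map_add' := fun v w => by ext i; simp
      map_smul' := fun c v => by ext i; simp }

theorem complexify_apply (v : EuclideanSpace ℝ (Fin n)) (i : Fin n) :
    complexify v i = ((v i : ℝ) : ℂ) := rfl

theorem realPart_apply (z : Fin n → ℂ) (i : Fin n) : realPart z i = (z i).re := rfl

theorem realPart_complexify (v : EuclideanSpace ℝ (Fin n)) : realPart (complexify v) = v := by
  ext i; simp [realPart_apply, complexify_apply]

theorem complexOp_complexify (A : Matrix (Fin n) (Fin n) ℝ) (v : EuclideanSpace ℝ (Fin n)) :
    complexOp A (complexify v) = complexify (matOp A v) := by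
  ext i
  simp [complexOp, complexify_apply, Matrix.mulVec, dotProduct, Matrix.toLpLin_apply]

theorem realPart_complexOp (A : Matrix (Fin n) (Fin n) ℝ) (z : Fin n → ℂ) :
    realPart (complexOp A z) = matOp A (realPart z) := by
  ext i
  simp [complexOp, realPart_apply, Matrix.mulVec, dotProduct, Matrix.toLpLin_apply]

theorem realPart_mem_stableSpace {A : Matrix (Fin n) (Fin n) ℝ} {z : Fin n → ℂ}
    (hz : z ∈ stableSpace fun _ => realOp (complexOp A)) :
    realPart z ∈ stableSpace fun _ => matOp A := by
  obtain ⟨u, hu, rfl, hu0⟩ := hz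
  refine ⟨fun t => realPart (u t), fun t => ?_, rfl, ?_⟩
  · have := realPart.hasFDerivAt.comp_hasDerivAt t (hu t)
    rw [realOp_apply, realPart_complexOp] at this
    exact this
  · simpa [Function.comp_def] using (realPart.continuous.tendsto 0).comp hu0

/-- Complexification and real part both intertwine the real and complex systems, so decaying
solutions transfer in either direction. -/
theorem complexify_mem_stableSpace_iff {A : Matrix (Fin n) (Fin n) ℝ}
    {v : EuclideanSpace ℝ (Fin n)} :
    complexify v ∈ stableSpace (fun _ => realOp (complexOp A)) ↔
      v ∈ stableSpace fun _ => matOp A := by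
  refine ⟨fun h => realPart_complexify v ▸ realPart_mem_stableSpace h, ?_⟩
  rintro ⟨u, hu, rfl, hu0⟩
  refine ⟨fun t => complexify (u t), fun t => ?_, rfl, ?_⟩
  · have := complexify.hasFDerivAt.comp_hasDerivAt t (hu t)
    rw [← complexOp_complexify] at this
    exact this
  · simpa [Function.comp_def] using (complexify.continuous.tendsto 0).comp hu0

theorem IsHyperbolic.re_ne_zero {A : Matrix (Fin n) (Fin n) ℝ} (hA : IsHyperbolic A) (μ : ℂ)
    (hμ : (complexOp A).HasEigenvalue μ) : μ.re ≠ 0 := by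
  refine hA μ ?_
  have := hμ.mem_spectrum
  rwa [complexOp, Matrix.spectrum_toLin'] at this

theorem IsHyperbolic.neg {A : Matrix (Fin n) (Fin n) ℝ} (hA : IsHyperbolic A) :
    IsHyperbolic (-A) := by
  intro μ hμ h
  have h1 : (-A).map (fun x : ℝ => (x : ℂ)) = -A.map (fun x : ℝ => (x : ℂ)) := by ext; simp
  rw [h1, ← spectrum.neg_eq] at hμ
  exact hA (-μ) (by simpa using hμ) (by simp [h])

/-- With time reversal, this reduces every statement about unstable subspaces to one about stable
subspaces. -/
theorem Vplus_eq_Vminus_neg (A : Matrix (Fin n) (Fin n) ℝ) : Vplus A = Vminus (-A) := by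
  ext v
  have h : ⨆ μ ∈ {μ : ℂ | 0 < μ.re}, (complexOp A).maxGenEigenspace μ =
      ⨆ μ ∈ {μ : ℂ | μ.re < 0}, (complexOp (-A)).maxGenEigenspace μ := by
    rw [iSup_maxGenEigenspace_pos, complexOp_neg]; rfl
  change complexify v ∈ (⨆ μ ∈ {μ : ℂ | 0 < μ.re}, (complexOp A).maxGenEigenspace μ) ↔
    complexify v ∈ ⨆ μ ∈ {μ : ℂ | μ.re < 0}, (complexOp (-A)).maxGenEigenspace μ
  rw [h]

/-- The negative spectral subspace consists of the initial values of decaying solutions. -/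
theorem Vminus_eq_stableSpace {A : Matrix (Fin n) (Fin n) ℝ} (hA : IsHyperbolic A) :
    Vminus A = stableSpace fun _ => matOp A := by
  ext v
  rw [← complexify_mem_stableSpace_iff, ← mem_negSpace_iff _ hA.re_ne_zero]
  rfl

/-- A hyperbolic matrix has a form with positive definite derivative, which is nonpositive on the
negative spectral subspace and nonnegative on a complement of it. -/
theorem IsHyperbolic.exists_form {A : Matrix (Fin n) (Fin n) ℝ} (hA : IsHyperbolic A) :
    ∃ B : EuclideanSpace ℝ (Fin n) →L[ℝ] EuclideanSpace ℝ (Fin n) →L[ℝ] ℝ,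
      (∀ v w, B v w = B w v) ∧ (∃ c > 0, ∀ v, c * ‖v‖ ^ 2 ≤ B (matOp A v) v) ∧
      (∀ v ∈ Vminus A, B v v ≤ 0) ∧ ∃ P : Submodule ℝ (EuclideanSpace ℝ (Fin n)),
        (∀ v ∈ P, 0 ≤ B v v) ∧ Module.finrank ℝ (Vminus A) + Module.finrank ℝ P =
          Module.finrank ℝ (EuclideanSpace ℝ (Fin n)) := by
  obtain ⟨BC, hsymmC, c, hc, hBC⟩ :=
    exists_form_of_re_eigenvalue_ne_zero (complexOp A) hA.re_ne_zero
  let B := BC.bilinearComp complexify complexify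
  have hB : ∀ v w, B v w = BC (complexify v) (complexify w) := fun _ _ => rfl
  have hsymm : ∀ v w, B v w = B w v := fun v w => by rw [hB, hB, hsymmC]
  set M := ‖(realPart : (Fin n → ℂ) →L[ℝ] EuclideanSpace ℝ (Fin n))‖ + 1 with hM
  have hM0 : 0 < M := by positivity
  have hform : ∀ v, c / M ^ 2 * ‖v‖ ^ 2 ≤ B (matOp A v) v := fun v => by
    have h1 : ‖v‖ ≤ M * ‖complexify v‖ := by
      conv_lhs => rw [← realPart_complexify v]
      exact realPart.le_of_opNorm_le (by linarith) _
    have h2 := hBC (complexify v)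
    rw [complexOp_complexify] at h2
    refine le_trans ?_ h2
    calc c / M ^ 2 * ‖v‖ ^ 2 ≤ c / M ^ 2 * (M * ‖complexify v‖) ^ 2 := by gcongr
      _ = _ := by field_simp
  have hform' : ∀ v, c / M ^ 2 * ‖v‖ ^ 2 ≤ (-B) ((-matOp A) v) v := fun v => by
    simpa using hform v
  have hc' : 0 < c / M ^ 2 := by positivity
  -- The complement is the stable space of `-A`: real parts of the complex spectral decomposition
  -- show that the two stable spaces span.
  refine ⟨B, hsymm, ⟨_, hc', hform⟩, ?_, stableSpace fun _ => -matOp A, ?_, ?_⟩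
  · rw [Vminus_eq_stableSpace hA]
    rintro _ ⟨u, hu, rfl, hu0⟩
    exact hu.form_nonpos_of_tendsto_zero hsymm hc' (T := 0) (fun _ _ => hform) hu0 le_rfl
  · rintro _ ⟨u, hu, rfl, hu0⟩
    have := hu.form_nonpos_of_tendsto_zero (B := -B) (fun v w => by simp [hsymm v w]) hc' (T := 0)
      (fun _ _ => hform') hu0 le_rfl
    simpa using this
  · rw [Vminus_eq_stableSpace hA]
    have hdisj := disjoint_stableSpace_const (A := matOp A) hsymm hc' hform
    have hsup : (stableSpace fun _ => matOp A) ⊔ (stableSpace fun _ => -matOp A) = ⊤ := by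
      rw [eq_top_iff]
      intro v _
      obtain ⟨x, hx, y, hy, hxy⟩ := Submodule.mem_sup.1
        (negSpace_sup_negSpace_neg (complexOp A) hA.re_ne_zero ▸ Submodule.mem_top :
          complexify v ∈ negSpace (complexOp A) ⊔ negSpace (-complexOp A))
      rw [← realPart_complexify v, ← hxy, map_add]
      refine Submodule.add_mem_sup (realPart_mem_stableSpace (negSpace_le_stableSpace _ hx)) ?_
      rw [← complexOp_neg] at hy
      have := realPart_mem_stableSpace (negSpace_le_stableSpace _ hy)
      rwa [map_neg] at this
    have := Submodule.finrank_sup_add_finrank_inf_eq (stableSpace fun _ => matOp A)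
      (stableSpace fun _ => -matOp A)
    rw [hsup, hdisj.eq_bot, finrank_bot, finrank_top, add_zero] at this
    exact this.symm

end RealMatrices

/-! ### Identification of `E^s` and `E^u` with stable spaces. -/

section FundamentalSolution

variable {n : ℕ} {S : ℝ → Matrix (Fin n) (Fin n) ℝ}

theorem continuous_matOp : Continuous (matOp (n := n)) :=
  LinearMap.continuous_of_finiteDimensional _

/-- Existence is what makes the `Classical.epsilon` in `fundamentalSolution` meet its specification.
-/
theorem exists_isFundamentalSolution (hS : Continuous S) (τ : ℝ) :
    ∃ γ, IsFundamentalSolution S τ γ := by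
  choose u hu huτ using fun j : Fin n => exists_isLinearSolution (continuous_matOp.comp hS) τ
    (EuclideanSpace.single j (1 : ℝ))
  refine ⟨fun t => Matrix.of fun i j => u j t i, fun t i j => ?_, ?_⟩
  · have h := (EuclideanSpace.proj (𝕜 := ℝ) i).hasFDerivAt.comp_hasDerivAt t (hu j t)
    convert! h using 1
  · ext i j
    simp [huτ, Matrix.one_apply]

theorem IsFundamentalSolution.isLinearSolution {τ : ℝ} {γ : ℝ → Matrix (Fin n) (Fin n) ℝ}
    (hγ : IsFundamentalSolution S τ γ) (v : EuclideanSpace ℝ (Fin n)) :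
    IsLinearSolution (fun t => matOp (S t)) fun t => Matrix.toEuclideanLin (γ t) v := by
  intro t
  have h : HasDerivAt (fun t => (γ t).mulVec v.ofLp) ((S t * γ t).mulVec v.ofLp) t := by
    rw [hasDerivAt_pi]
    intro i
    simp only [Matrix.mulVec, dotProduct]
    exact HasDerivAt.fun_sum fun j _ => (hγ.1 t i j).mul_const (v j)
  have h' := (PiLp.continuousLinearEquiv 2 ℝ fun _ : Fin n => ℝ).symm.hasFDerivAt.comp_hasDerivAt
    t h
  convert! h' using 1
  simp [Matrix.toLpLin_apply]

/-- The stable subspace at time `τ` is the stable space of the equation shifted by `τ`. -/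
theorem stableSubspace_eq_stableSpace (hS : Continuous S) (τ : ℝ) :
    stableSubspace S τ = stableSpace fun t => matOp (S (τ + t)) := by
  have hγ : IsFundamentalSolution S τ (fundamentalSolution S τ) :=
    Classical.epsilon_spec (exists_isFundamentalSolution hS τ)
  have hA : Continuous fun t => matOp (S (τ + t)) :=
    continuous_matOp.comp (hS.comp (continuous_const_add τ))
  ext v
  have hsol : IsLinearSolution (fun t => matOp (S (τ + t)))
      fun t => Matrix.toEuclideanLin (fundamentalSolution S τ (τ + t)) v := by
    simpa [add_comm τ] using (hγ.isLinearSolution v).comp_add_const τ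
  have h0 : Matrix.toEuclideanLin (fundamentalSolution S τ (τ + 0)) v = v := by
    rw [add_zero, hγ.2]; simp
  have hshift : Tendsto (fun t => Matrix.toEuclideanLin (fundamentalSolution S τ t) v) atTop (𝓝 0) ↔
      Tendsto (fun t => Matrix.toEuclideanLin (fundamentalSolution S τ (τ + t)) v) atTop (𝓝 0) := by
    constructor
    · exact fun h => h.comp (tendsto_atTop_add_const_left _ τ tendsto_id)
    · intro h
      simpa [Function.comp_def] using h.comp (tendsto_atTop_add_const_left _ (-τ) tendsto_id)
  change Tendsto _ _ _ ↔ _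
  rw [hshift]
  constructor
  · exact fun h => ⟨_, hsol, h0, h⟩
  · rintro ⟨u, hu, rfl, hu0⟩
    rwa [hsol.eq_of_eq hA hu (t₀ := 0) h0]

/-- The unstable subspace at time `-τ` is the stable subspace at time `τ` of the reflected
equation. -/
theorem unstableSubspace_neg (hS : Continuous S) (τ : ℝ) :
    unstableSubspace S (-τ) = stableSubspace (fun t => -S (-t)) τ := by
  have hγ : IsFundamentalSolution S (-τ) (fundamentalSolution S (-τ)) :=
    Classical.epsilon_spec (exists_isFundamentalSolution hS (-τ))
  have hS' : Continuous fun t => -S (-t) := (hS.comp continuous_neg).neg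
  have hγ' : IsFundamentalSolution (fun t => -S (-t)) τ
      (fundamentalSolution (fun t => -S (-t)) τ) :=
    Classical.epsilon_spec (exists_isFundamentalSolution hS' τ)
  ext v
  have h1 := (hγ.isLinearSolution v).comp_neg
  have h2 := hγ'.isLinearSolution v
  simp only [map_neg] at h2
  have hA : Continuous fun t => -matOp (S (-t)) :=
    (continuous_matOp.comp (hS.comp continuous_neg)).neg
  have heq := h1.eq_of_eq hA h2 (t₀ := τ) (by simp [hγ.2, hγ'.2])
  change Tendsto _ _ _ ↔ Tendsto _ _ _
  rw [← heq]
  constructor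
  · exact fun h => h.comp tendsto_neg_atTop_atBot
  · intro h
    simpa [Function.comp_def] using h.comp tendsto_neg_atBot_atTop

end FundamentalSolution

/-! ### Compactification of the time axis. -/

section Compactification

variable {E : Type*} [NormedAddCommGroup E] [NormedSpace ℝ E]

/-- The equations `C lam` shifted by the time `s / (1 - s)`, completed by the limit equations at
`s = 1`. -/
noncomputable def shiftFamily (C : ℝ → ℝ → E →L[ℝ] E) (C₀ : ℝ → E →L[ℝ] E) (p : ℝ × ℝ) (t : ℝ) :
    E →L[ℝ] E :=
  -- The maximum keeps every shift nonnegative, so estimates valid for times beyond `T` hold for all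
  -- shifted equations at once, also at negative `s`.
  if p.2 < 1 then C p.1 (max p.2 0 / (1 - p.2) + t) else C₀ p.1

/-- The shift blows up as `s` increases to `1`. The premise `s < 1` sits inside the eventuality
because a neighbourhood of `s₀` may also contain points where no shift is made. -/
theorem eventually_le_shift {s₀ : ℝ} (hs₀ : 1 ≤ s₀) (R : ℝ) :
    ∀ᶠ s in 𝓝 s₀, s < 1 → R ≤ max s 0 / (1 - s) := by
  have h : max (1 / 2) (1 - 1 / (2 * (|R| + 1))) < s₀ := by
    refine lt_of_lt_of_le (max_lt (by norm_num) ?_) hs₀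
    have : 0 < 1 / (2 * (|R| + 1)) := by positivity
    linarith
  filter_upwards [lt_mem_nhds h] with s hs hs1
  have h1 := (le_max_left _ _).trans_lt hs
  have h2 := (le_max_right _ _).trans_lt hs
  have h3 : 1 - s < 1 / (2 * (|R| + 1)) := by linarith
  rw [lt_div_iff₀ (by positivity)] at h3
  rw [max_eq_left (by linarith), le_div_iff₀ (by linarith)]
  have h4 : R * (1 - s) ≤ |R| * (1 - s) :=
    mul_le_mul_of_nonneg_right (le_abs_self R) (by linarith)
  nlinarith

/-- Only `s₀ ≥ 1` needs an argument: nearby `s < 1` have huge shifts, where uniform convergence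
brings `C` close to `C₀`, itself continuous in the parameter. -/
theorem continuous_shiftFamily {C : ℝ → ℝ → E →L[ℝ] E} {C₀ : ℝ → E →L[ℝ] E}
    (hC : Continuous fun p : ℝ × ℝ => C p.1 p.2) (hC₀ : Continuous C₀)
    (hlim : ∀ ε > 0, ∃ T, ∀ t, T ≤ t → ∀ lam, ‖C lam t - C₀ lam‖ ≤ ε) :
    Continuous fun q : (ℝ × ℝ) × ℝ => shiftFamily C C₀ q.1 q.2 := by
  rw [continuous_iff_continuousAt]
  rintro ⟨⟨lam₀, s₀⟩, t₀⟩
  rcases lt_or_ge s₀ 1 with hs₀ | hs₀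
  · have heq : (fun q : (ℝ × ℝ) × ℝ => shiftFamily C C₀ q.1 q.2) =ᶠ[𝓝 ((lam₀, s₀), t₀)]
        fun q => C q.1.1 (max q.1.2 0 / (1 - q.1.2) + q.2) := by
      have : ∀ᶠ q : (ℝ × ℝ) × ℝ in 𝓝 ((lam₀, s₀), t₀), q.1.2 < 1 :=
        (continuous_snd.comp continuous_fst).continuousAt.eventually (gt_mem_nhds hs₀)
      filter_upwards [this] with q hq
      simp [shiftFamily, hq]
    refine ContinuousAt.congr ?_ heq.symm
    have h1 : ContinuousAt (fun q : (ℝ × ℝ) × ℝ => max q.1.2 0 / (1 - q.1.2) + q.2)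
        ((lam₀, s₀), t₀) := by
      refine ContinuousAt.add (ContinuousAt.div (by fun_prop) (by fun_prop) ?_) (by fun_prop)
      simp only; linarith
    exact ContinuousAt.comp (f := fun q : (ℝ × ℝ) × ℝ =>
      (q.1.1, max q.1.2 0 / (1 - q.1.2) + q.2)) hC.continuousAt
      (ContinuousAt.prodMk (by fun_prop) h1)
  · rw [Metric.continuousAt_iff']
    intro ε hε
    obtain ⟨T, hT⟩ := hlim (ε / 2) (by positivity)
    have e1 : ∀ᶠ q : (ℝ × ℝ) × ℝ in 𝓝 ((lam₀, s₀), t₀),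
        q.1.2 < 1 → T - (t₀ - 1) ≤ max q.1.2 0 / (1 - q.1.2) := by
      have h : Tendsto (fun q : (ℝ × ℝ) × ℝ => q.1.2) (𝓝 ((lam₀, s₀), t₀)) (𝓝 s₀) :=
        (continuous_snd.comp continuous_fst).tendsto _
      exact h.eventually (eventually_le_shift hs₀ _)
    have e2 : ∀ᶠ q : (ℝ × ℝ) × ℝ in 𝓝 ((lam₀, s₀), t₀), t₀ - 1 < q.2 :=
      continuous_snd.continuousAt.eventually (lt_mem_nhds (by simp))
    have e3 : ∀ᶠ q : (ℝ × ℝ) × ℝ in 𝓝 ((lam₀, s₀), t₀), dist (C₀ q.1.1) (C₀ lam₀) < ε / 2 :=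
      ((hC₀.comp (continuous_fst.comp continuous_fst)).continuousAt
        (x := ((lam₀, s₀), t₀))).eventually (Metric.ball_mem_nhds _ (by positivity))
    filter_upwards [e1, e2, e3] with q h1 h2 h3
    have h4 : shiftFamily C C₀ (lam₀, s₀) t₀ = C₀ lam₀ := by simp [shiftFamily, hs₀]
    rw [h4]
    rcases lt_or_ge q.1.2 1 with hq | hq
    · have h5 : shiftFamily C C₀ q.1 q.2 = C q.1.1 (max q.1.2 0 / (1 - q.1.2) + q.2) := by
        simp [shiftFamily, hq]
      have h6 := hT (max q.1.2 0 / (1 - q.1.2) + q.2) (by linarith [h1 hq]) q.1.1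
      rw [← dist_eq_norm] at h6
      rw [h5]
      linarith [dist_triangle (C q.1.1 (max q.1.2 0 / (1 - q.1.2) + q.2)) (C₀ q.1.1) (C₀ lam₀)]
    · have h5 : shiftFamily C C₀ q.1 q.2 = C₀ q.1.1 := by
        simp [shiftFamily, hq]
      rw [h5]; linarith

/-- The shifted equations stay close to the limit equation for large times. -/
theorem eventually_norm_shiftFamily_sub_le {C : ℝ → ℝ → E →L[ℝ] E} {C₀ : ℝ → E →L[ℝ] E}
    (hC₀ : Continuous C₀)
    (hlim : ∀ ε > 0, ∃ T, ∀ t, T ≤ t → ∀ lam, ‖C lam t - C₀ lam‖ ≤ ε) (p₀ : ℝ × ℝ) {ε : ℝ}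
    (hε : 0 < ε) : ∃ T, 0 ≤ T ∧ ∀ᶠ p in 𝓝 p₀, ∀ t, T ≤ t →
      ‖shiftFamily C C₀ p t - C₀ p₀.1‖ ≤ ε := by
  obtain ⟨T, hT⟩ := hlim (ε / 2) (by positivity)
  refine ⟨max T 0, le_max_right _ _, ?_⟩
  have e : ∀ᶠ p : ℝ × ℝ in 𝓝 p₀, dist (C₀ p.1) (C₀ p₀.1) < ε / 2 :=
    ((hC₀.comp continuous_fst).continuousAt (x := p₀)).eventually
      (Metric.ball_mem_nhds _ (by positivity))
  filter_upwards [e] with p hp t ht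
  rw [← dist_eq_norm]
  rcases lt_or_ge p.2 1 with h | h
  · have h5 : shiftFamily C C₀ p t = C p.1 (max p.2 0 / (1 - p.2) + t) := by
      simp [shiftFamily, h]
    have h0 : 0 ≤ max p.2 0 / (1 - p.2) := div_nonneg (le_max_right _ _) (by linarith)
    have h6 := hT (max p.2 0 / (1 - p.2) + t) (by linarith [le_max_left T 0]) p.1
    rw [← dist_eq_norm] at h6
    rw [h5]
    linarith [dist_triangle (C p.1 (max p.2 0 / (1 - p.2) + t)) (C₀ p.1) (C₀ p₀.1)]
  · have h5 : shiftFamily C C₀ p t = C₀ p.1 := by simp [shiftFamily, h]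
    rw [h5]; linarith

end Compactification

/-! ### Stable families up to infinite time. -/

section StableFamily

variable {n : ℕ}

/-- Positivity of `B (A v) v` is an open condition on `A`. After a late time all shifts near `p₀`
stay within `ε` of the limit operator at `p₀`, and `ε` is chosen so that this costs at most half of
`c`. One form thus serves a whole neighbourhood, including `s = 1`. -/
theorem exists_form_shiftFamily {C : ℝ → ℝ → EuclideanSpace ℝ (Fin n) →L[ℝ] EuclideanSpace ℝ (Fin n)}
    {M : ℝ → Matrix (Fin n) (Fin n) ℝ} (hM : Continuous fun lam => matOp (M lam))
    (hyp : ∀ lam, IsHyperbolic (M lam))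
    (hlim : ∀ ε > 0, ∃ T, ∀ t, T ≤ t → ∀ lam, ‖C lam t - matOp (M lam)‖ ≤ ε) (p₀ : ℝ × ℝ) :
    ∃ B : EuclideanSpace ℝ (Fin n) →L[ℝ] EuclideanSpace ℝ (Fin n) →L[ℝ] ℝ,
    (∀ v w, B v w = B w v) ∧ (∀ v ∈ Vminus (M p₀.1), B v v ≤ 0) ∧
    (∃ P : Submodule ℝ (EuclideanSpace ℝ (Fin n)),
      (∀ v ∈ P, 0 ≤ B v v) ∧ Module.finrank ℝ (Vminus (M p₀.1)) + Module.finrank ℝ P =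
        Module.finrank ℝ (EuclideanSpace ℝ (Fin n))) ∧
    ∃ c > 0, ∃ T K, 0 ≤ T ∧ (∀ᶠ p in 𝓝 p₀, ∀ t, T ≤ t →
        ∀ v, c * ‖v‖ ^ 2 ≤ B (shiftFamily C (fun lam => matOp (M lam)) p t v) v) ∧
      ∀ᶠ p in 𝓝 p₀, ∀ t, T ≤ t → ‖shiftFamily C (fun lam => matOp (M lam)) p t‖ ≤ K := by
  obtain ⟨B, hsymm, ⟨c, hc, hB⟩, hN, hP⟩ := (hyp p₀.1).exists_form
  set ε := c / (2 * (‖B‖ + 1)) with hε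
  have hεpos : 0 < ε := by positivity
  have hεB : ‖B‖ * ε ≤ c / 2 := by
    rw [hε, mul_div_assoc', div_le_div_iff₀ (by positivity) (by positivity)]
    nlinarith [norm_nonneg B]
  obtain ⟨T, hT0, hT⟩ := eventually_norm_shiftFamily_sub_le hM hlim p₀ hεpos
  refine ⟨B, hsymm, hN, hP, c / 2, by positivity, T, ‖matOp (M p₀.1)‖ + ε, hT0, ?_, ?_⟩
  · filter_upwards [hT] with p hp t ht v
    have h1 : B (shiftFamily C (fun lam => matOp (M lam)) p t v) v = B (matOp (M p₀.1) v) v +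
        B ((shiftFamily C (fun lam => matOp (M lam)) p t - matOp (M p₀.1)) v) v := by
      simp
    have h2 := (abs_le.1 (B.le_opNorm₂ ((shiftFamily C (fun lam => matOp (M lam)) p t - matOp (M p₀.1)) v) v)).1
    have h3 : ‖B‖ * ‖(shiftFamily C (fun lam => matOp (M lam)) p t - matOp (M p₀.1)) v‖ * ‖v‖ ≤ c / 2 * ‖v‖ ^ 2 := by
      calc ‖B‖ * ‖(shiftFamily C (fun lam => matOp (M lam)) p t - matOp (M p₀.1)) v‖ * ‖v‖ ≤ ‖B‖ * (ε * ‖v‖) * ‖v‖ := by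
            gcongr
            exact ContinuousLinearMap.le_of_opNorm_le _ (hp t ht) v
        _ = ‖B‖ * ε * ‖v‖ ^ 2 := by ring
        _ ≤ _ := by gcongr
    have h4 : c * ‖v‖ ^ 2 ≤ B (matOp (M p₀.1) v) v := hB v
    rw [h1]
    linarith
  · filter_upwards [hT] with p hp t ht
    have := norm_le_norm_add_norm_sub' (shiftFamily C (fun lam => matOp (M lam)) p t) (matOp (M p₀.1))
    linarith [hp t ht]

/-- The stable spaces of the shifts of an asymptotically hyperbolic family have constant dimension
and are continuous up to `s = 1`. -/
theorem stableSpace_shiftFamily {d : ℕ}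
    {C : ℝ → ℝ → EuclideanSpace ℝ (Fin n) →L[ℝ] EuclideanSpace ℝ (Fin n)}
    {M : ℝ → Matrix (Fin n) (Fin n) ℝ} (hC : Continuous fun p : ℝ × ℝ => C p.1 p.2)
    (hM : Continuous fun lam => matOp (M lam)) (hyp : ∀ lam, IsHyperbolic (M lam))
    (hlim : ∀ ε > 0, ∃ T, ∀ t, T ≤ t → ∀ lam, ‖C lam t - matOp (M lam)‖ ≤ ε)
    (hd : ∀ lam, Module.finrank ℝ (Vminus (M lam)) = d) :
    (∀ p, Module.finrank ℝ (stableSpace (shiftFamily C (fun lam => matOp (M lam)) p)) = d) ∧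
      Continuous fun p =>
        (stableSpace (shiftFamily C (fun lam => matOp (M lam)) p)).starProjection := by
  have hcont := continuous_shiftFamily hC hM hlim
  have hslice : ∀ p, Continuous (shiftFamily C (fun lam => matOp (M lam)) p) := fun p =>
    hcont.comp (f := fun t : ℝ => (p, t)) (Continuous.prodMk_right p)
  have hfin : ∀ p, Module.finrank ℝ
      (stableSpace (shiftFamily C (fun lam => matOp (M lam)) p)) = d := by
    intro p
    obtain ⟨B, hsymm, hN, ⟨P, hP, hNP⟩, c, hc, T, K, hT, hB, hK⟩ :=
      exists_form_shiftFamily hM hyp hlim p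
    rw [← hd p.1]
    exact finrank_stableSpace (hslice p) hsymm hc hB.self_of_nhds hK.self_of_nhds hN hP hNP
  refine ⟨hfin, continuous_iff_continuousAt.2 fun p => ?_⟩
  obtain ⟨B, hsymm, -, -, c, hc, T, K, hT, hB, hK⟩ := exists_form_shiftFamily hM hyp hlim p
  exact continuousAt_stableSpace hcont hfin hsymm hc hT hB hK

/-- For an asymptotically hyperbolic family, the stable subspaces at time `s / (1 - s)` form,
together with the negative spectral subspaces of the limits at `s = 1`, a continuous family. -/
theorem exists_stable_family {d : ℕ} {S : ℝ → ℝ → Matrix (Fin n) (Fin n) ℝ}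
    {Splus : ℝ → Matrix (Fin n) (Fin n) ℝ}
    (hS : ContinuousOn (fun p : ℝ × ℝ => S p.1 p.2) (Icc 0 1 ×ˢ univ))
    (hplus : TendstoUniformlyOn (fun t lam => S lam t) Splus atTop (Icc 0 1))
    (hyp : ∀ lam ∈ Icc (0 : ℝ) 1, IsHyperbolic (Splus lam))
    (hd : ∀ lam ∈ Icc (0 : ℝ) 1, Module.finrank ℝ (Vminus (Splus lam)) = d) :
    ∃ G : ℝ × ℝ → Submodule ℝ (EuclideanSpace ℝ (Fin n)),
      Continuous (fun p => (G p).starProjection) ∧ (∀ p, Module.finrank ℝ (G p) = d) ∧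
      (∀ lam ∈ Icc (0 : ℝ) 1, ∀ t, 0 ≤ t → G (lam, t / (1 + t)) = stableSubspace (S lam) t) ∧
      ∀ lam ∈ Icc (0 : ℝ) 1, G (lam, 1) = Vminus (Splus lam) := by
  -- Retracting the parameter onto `[0, 1]` extends the family to all of `ℝ`, so that continuity is
  -- global.
  let π : ℝ → ℝ := fun lam => projIcc (0 : ℝ) 1 zero_le_one lam
  have hπ : Continuous π := continuous_subtype_val.comp continuous_projIcc
  have hπ_mem : ∀ lam, π lam ∈ Icc (0 : ℝ) 1 := fun lam => (projIcc 0 1 zero_le_one lam).2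
  have hπ_eq : ∀ lam ∈ Icc (0 : ℝ) 1, π lam = lam := fun lam h => by
    simp only [π, projIcc_of_mem zero_le_one h]
  have hSlam : ∀ lam ∈ Icc (0 : ℝ) 1, Continuous (S lam) := fun lam h =>
    hS.comp_continuous (f := fun t : ℝ => (lam, t)) (by fun_prop) fun t => ⟨h, mem_univ t⟩
  have hSp : ContinuousOn Splus (Icc 0 1) := by
    refine hplus.continuousOn (Frequently.of_forall fun t => ?_)
    exact hS.comp (f := fun lam : ℝ => (lam, t)) (by fun_prop) fun lam h => ⟨h, mem_univ t⟩
  let C : ℝ → ℝ → _ := fun lam t => matOp (S (π lam) t)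
  let C₀ : ℝ → _ := fun lam => matOp (Splus (π lam))
  have hC : Continuous fun p : ℝ × ℝ => C p.1 p.2 :=
    continuous_matOp.comp (hS.comp_continuous (f := fun p : ℝ × ℝ => (π p.1, p.2)) (by fun_prop)
      fun p => ⟨hπ_mem _, mem_univ _⟩)
  have hC₀ : Continuous C₀ := continuous_matOp.comp (hSp.comp_continuous hπ hπ_mem)
  have hlim : ∀ ε > 0, ∃ T, ∀ t, T ≤ t → ∀ lam, ‖C lam t - C₀ lam‖ ≤ ε := by
    intro ε hε
    have hu : UniformContinuous (matOp (n := n)) := by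
      exact uniformContinuous_addMonoidHom_of_continuous
        (f := (matOp (n := n)).toAddMonoidHom) continuous_matOp
    have := Metric.tendstoUniformlyOn_iff.1 (hu.comp_tendstoUniformlyOn hplus) ε hε
    obtain ⟨T, hT⟩ := eventually_atTop.1 this
    refine ⟨T, fun t ht lam => ?_⟩
    rw [← dist_eq_norm, dist_comm]
    exact (hT t ht (π lam) (hπ_mem lam)).le
  obtain ⟨hfin, hGcont⟩ := stableSpace_shiftFamily (M := fun lam => Splus (π lam)) hC hC₀
    (fun lam => hyp _ (hπ_mem lam)) hlim fun lam => hd _ (hπ_mem lam)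
  refine ⟨fun p => stableSpace (shiftFamily C C₀ p), hGcont, hfin, ?_, ?_⟩
  · intro lam hlam t ht
    rw [stableSubspace_eq_stableSpace (hSlam lam hlam)]
    refine congrArg stableSpace (funext fun s => ?_)
    have h1 : t / (1 + t) < 1 := by rw [div_lt_one (by linarith)]; linarith
    -- The shift attached to `s = t / (1 + t)` is exactly `t`.
    have h2 : max (t / (1 + t)) 0 / (1 - t / (1 + t)) = t := by
      rw [max_eq_left (by positivity)]
      have : 1 + t ≠ 0 := by positivity
      field_simp
      simp
    simp only [shiftFamily, h1, if_true, h2, C, hπ_eq lam hlam]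
  · intro lam hlam
    rw [Vminus_eq_stableSpace (hyp lam hlam)]
    refine congrArg stableSpace (funext fun s => ?_)
    simp only [shiftFamily, lt_irrefl, if_false, C₀, hπ_eq lam hlam]

end StableFamily

/-! ### Frames, determinants and the index. -/

section Frames

variable {n k l : ℕ}

theorem mul_pos_of_continuousOn_ne_zero {f : ℝ → ℝ} {a b : ℝ} (hab : a ≤ b)
    (hf : ContinuousOn f (Icc a b)) (h0 : ∀ t ∈ Icc a b, f t ≠ 0) : 0 < f a * f b := by
  have ha := h0 a (left_mem_Icc.2 hab)
  have hb := h0 b (right_mem_Icc.2 hab)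
  by_contra! h
  rcases mul_neg_iff.1 (lt_of_le_of_ne h (mul_ne_zero ha hb)) with ⟨h1, h2⟩ | ⟨h1, h2⟩
  · obtain ⟨t, ht, h3⟩ := intermediate_value_Icc' hab hf ⟨h2.le, h1.le⟩
    exact h0 t ht h3
  · obtain ⟨t, ht, h3⟩ := intermediate_value_Icc hab hf ⟨h1.le, h2.le⟩
    exact h0 t ht h3

/-- The index set of the columns of a frame matrix. -/
def colEquiv (h : k + l = n) : Fin k ⊕ Fin l ≃ Fin n :=
  finSumFinEquiv.trans (finCongr h)

theorem frameMatrix_apply_colEquiv (h : k + l = n) (v : Fin k → EuclideanSpace ℝ (Fin n))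
    (w : Fin l → EuclideanSpace ℝ (Fin n)) (i : Fin n) (s : Fin k ⊕ Fin l) :
    frameMatrix h v w i (colEquiv h s) = (Sum.elim v w s) i := by
  subst h
  rcases s with s | s
  · exact congrArg (fun x : EuclideanSpace ℝ _ => x i) (Fin.append_left v w s)
  · exact congrArg (fun x : EuclideanSpace ℝ _ => x i) (Fin.append_right v w s)

/-- Changing the two frames multiplies the frame matrix by a block diagonal matrix. -/
theorem det_frameMatrix_change (h : k + l = n) {v v' : Fin k → EuclideanSpace ℝ (Fin n)}
    {w w' : Fin l → EuclideanSpace ℝ (Fin n)} {A : Matrix (Fin k) (Fin k) ℝ}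
    {C : Matrix (Fin l) (Fin l) ℝ} (hv : ∀ j, v' j = ∑ i, A i j • v i)
    (hw : ∀ j, w' j = ∑ i, C i j • w i) :
    (frameMatrix h v' w').det = (frameMatrix h v w).det * (A.det * C.det) := by
  have key : frameMatrix h v' w' = frameMatrix h v w *
      (Matrix.fromBlocks A 0 0 C).submatrix (colEquiv h).symm (colEquiv h).symm := by
    ext i j
    obtain ⟨s, rfl⟩ := (colEquiv h).surjective j
    rw [Matrix.mul_apply, ← (colEquiv h).sum_comp, frameMatrix_apply_colEquiv]
    simp only [frameMatrix_apply_colEquiv, Matrix.submatrix_apply, Equiv.symm_apply_apply,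
      Fintype.sum_sum_type]
    rcases s with s | s
    · simp [hv, mul_comm]
    · simp [hw, mul_comm]
  rw [key, Matrix.det_mul, Matrix.det_submatrix_equiv_self, Matrix.det_fromBlocks_zero₂₁]

theorem exists_change_of_span_eq {E : Type*} [AddCommGroup E] [Module ℝ E] {v v' : Fin k → E}
    (hspan : Submodule.span ℝ (range v) = Submodule.span ℝ (range v')) :
    ∃ A : Matrix (Fin k) (Fin k) ℝ, ∀ j, v' j = ∑ i, A i j • v i := by
  have : ∀ j, ∃ c : Fin k → ℝ, ∑ i, c i • v i = v' j := fun j =>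
    (Submodule.mem_span_range_iff_exists_fun ℝ).1
      (hspan ▸ Submodule.subset_span (mem_range_self j))
  choose c hc using this
  exact ⟨Matrix.of fun i j => c j i, fun j => (hc j).symm⟩

theorem det_change_ne_zero {E : Type*} [AddCommGroup E] [Module ℝ E] {v v' : Fin k → E}
    (hv' : LinearIndependent ℝ v') {A : Matrix (Fin k) (Fin k) ℝ}
    (hA : ∀ j, v' j = ∑ i, A i j • v i) : A.det ≠ 0 := by
  intro hdet
  obtain ⟨x, hx, hAx⟩ := Matrix.exists_mulVec_eq_zero_iff.2 hdet
  refine hx (funext fun j => Fintype.linearIndependent_iff.1 hv' x ?_ j)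
  simp only [hA, Finset.smul_sum, smul_smul]
  rw [Finset.sum_comm]
  refine Finset.sum_eq_zero fun i _ => ?_
  rw [← Finset.sum_smul]
  have : ∑ j, x j * A i j = 0 := by
    have := congrFun hAx i
    simpa [Matrix.mulVec, dotProduct, mul_comm] using this
  rw [this, zero_smul]

/-- The left side is continuous for continuous frames, and the Gram determinant of a frame is
positive. The sign of the change-of-frame determinant can thus be followed in time without proving
that the change matrix itself is continuous. -/
theorem det_inner_eq_det_gram_mul {E : Type*} [NormedAddCommGroup E] [InnerProductSpace ℝ E]
    {v v' : Fin k → E} {A : Matrix (Fin k) (Fin k) ℝ} (hA : ∀ j, v' j = ∑ i, A i j • v i) :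
    (Matrix.of fun i j => inner ℝ (v i) (v' j)).det = (Matrix.gram ℝ v).det * A.det := by
  rw [← Matrix.det_mul]
  congr 1
  ext i j
  simp [Matrix.mul_apply, hA, inner_sum, inner_smul_right, mul_comm]

/-- The determinants of the changes of frame at the two ends have the same sign. -/
theorem det_change_mul_pos {V : ℝ → Submodule ℝ (EuclideanSpace ℝ (Fin n))} {a b : ℝ}
    (hab : a ≤ b) {v v' : ℝ → Fin k → EuclideanSpace ℝ (Fin n)} (hv : IsFrame V a b v)
    (hv' : IsFrame V a b v') {A B : Matrix (Fin k) (Fin k) ℝ}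
    (hA : ∀ j, v' a j = ∑ i, A i j • v a i) (hB : ∀ j, v' b j = ∑ i, B i j • v b i) :
    0 < A.det * B.det := by
  have hcont : ContinuousOn (fun t => (Matrix.of fun i j => inner ℝ (v t i) (v' t j)).det)
      (Icc a b) := by
    refine Continuous.comp_continuousOn (g := Matrix.det) (by fun_prop) ?_
    refine continuousOn_pi.2 fun i => continuousOn_pi.2 fun j => ?_
    exact (continuousOn_pi.1 hv.1 i).inner (𝕜 := ℝ) (continuousOn_pi.1 hv'.1 j)
  have hgram : ∀ t ∈ Icc a b, 0 < (Matrix.gram ℝ (v t)).det := fun t ht =>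
    (Matrix.posDef_gram_of_linearIndependent (𝕜 := ℝ) (hv.2 t ht).1).det_pos
  have h := mul_pos_of_continuousOn_ne_zero hab hcont fun t ht => by
    obtain ⟨D, hD⟩ := exists_change_of_span_eq ((hv.2 t ht).2.trans (hv'.2 t ht).2.symm)
    rw [det_inner_eq_det_gram_mul hD]
    exact mul_ne_zero (hgram t ht).ne' (det_change_ne_zero (hv'.2 t ht).1 hD)
  rw [det_inner_eq_det_gram_mul hA, det_inner_eq_det_gram_mul hB] at h
  have ha := hgram a (left_mem_Icc.2 hab)
  have hb := hgram b (right_mem_Icc.2 hab)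
  refine pos_of_mul_pos_right (a := (Matrix.gram ℝ (v a)).det * (Matrix.gram ℝ (v b)).det) ?_
    (mul_pos ha hb).le
  linarith

open Classical in
/-- The index can be computed with any pair of frames. -/
theorem z2Index_eq {V W : ℝ → Submodule ℝ (EuclideanSpace ℝ (Fin n))} {a b : ℝ} (hab : a ≤ b)
    (h : k + l = n) {v : ℝ → Fin k → EuclideanSpace ℝ (Fin n)}
    {w : ℝ → Fin l → EuclideanSpace ℝ (Fin n)} (hv : IsFrame V a b v) (hw : IsFrame W a b w) :
    z2Index V W a b =
      if (frameMatrix h (v a) (w a)).det * (frameMatrix h (v b) (w b)).det < 0 then 1 else 0 := by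
  have ha : a ∈ Icc a b := left_mem_Icc.2 hab
  have hb : b ∈ Icc a b := right_mem_Icc.2 hab
  rw [z2Index]
  refine if_congr ⟨?_, fun hneg => ⟨k, l, h, v, w, hv, hw, by rwa [Matrix.det_mul]⟩⟩ rfl rfl
  rintro ⟨k', l', h', v', w', hv', hw', hneg⟩
  -- The subspaces determine the frame lengths; after that, new frames multiply the product of end
  -- determinants by a positive number.
  obtain rfl : k' = k := by
    have h1 := finrank_span_eq_card (hv.2 a ha).1
    have h2 := finrank_span_eq_card (hv'.2 a ha).1
    rw [(hv.2 a ha).2, Fintype.card_fin] at h1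
    rw [(hv'.2 a ha).2, Fintype.card_fin] at h2
    omega
  obtain rfl : l' = l := by omega
  obtain ⟨A, hA⟩ := exists_change_of_span_eq ((hv.2 a ha).2.trans (hv'.2 a ha).2.symm)
  obtain ⟨B, hB⟩ := exists_change_of_span_eq ((hv.2 b hb).2.trans (hv'.2 b hb).2.symm)
  obtain ⟨C, hC⟩ := exists_change_of_span_eq ((hw.2 a ha).2.trans (hw'.2 a ha).2.symm)
  obtain ⟨D, hD⟩ := exists_change_of_span_eq ((hw.2 b hb).2.trans (hw'.2 b hb).2.symm)
  have h1 := det_change_mul_pos hab hv hv' hA hB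
  have h2 := det_change_mul_pos hab hw hw' hC hD
  rw [Matrix.det_mul, det_frameMatrix_change h hA hC, det_frameMatrix_change h hB hD] at hneg
  by_contra! h3
  have h4 := mul_nonneg h3 (mul_pos h1 h2).le
  linarith

theorem det_frameMatrix_ne_zero_iff (h : k + l = n) {v : Fin k → EuclideanSpace ℝ (Fin n)}
    {w : Fin l → EuclideanSpace ℝ (Fin n)} :
    (frameMatrix h v w).det ≠ 0 ↔
      Transversal (Submodule.span ℝ (range v)) (Submodule.span ℝ (range w)) := by
  have hcol : (frameMatrix h v w).col ∘ colEquiv h =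
      (WithLp.linearEquiv 2 ℝ (Fin n → ℝ)) ∘ Sum.elim v w := by
    funext s
    ext i
    exact frameMatrix_apply_colEquiv h v w i s
  rw [← isUnit_iff_ne_zero, ← Matrix.isUnit_iff_isUnit_det,
    ← Matrix.linearIndependent_cols_iff_isUnit, ← linearIndependent_equiv (colEquiv h), hcol]
  have h1 : LinearIndependent ℝ ((WithLp.linearEquiv 2 ℝ (Fin n → ℝ)) ∘ Sum.elim v w) ↔
      LinearIndependent ℝ (Sum.elim v w) :=
    LinearMap.linearIndependent_iff (WithLp.linearEquiv 2 ℝ (Fin n → ℝ)).toLinearMap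
      (LinearEquiv.ker _)
  rw [h1, linearIndependent_iff_card_eq_finrank_span, Set.finrank, Sum.elim_range,
    Submodule.span_union, Transversal, Fintype.card_sum, Fintype.card_fin, Fintype.card_fin, h]
  constructor
  · intro h2
    exact Submodule.eq_top_of_finrank_eq (by rw [← h2, finrank_euclideanSpace_fin])
  · intro h2
    rw [h2, finrank_top, finrank_euclideanSpace_fin]

/-- Exchanging the two frames changes the determinant by a constant sign. -/
theorem exists_sign_det_frameMatrix_swap (h : k + l = n) (h' : l + k = n) :
    ∃ ε : ℝ, ε * ε = 1 ∧ ∀ (v : Fin k → EuclideanSpace ℝ (Fin n))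
      (w : Fin l → EuclideanSpace ℝ (Fin n)),
      (frameMatrix h v w).det = ε * (frameMatrix h' w v).det := by
  let σ : Equiv.Perm (Fin n) :=
    ((colEquiv h).symm.trans (Equiv.sumComm (Fin k) (Fin l))).trans (colEquiv h')
  refine ⟨((Equiv.Perm.sign σ : ℤ) : ℝ), ?_, fun v w => ?_⟩
  · rcases Int.units_eq_one_or (Equiv.Perm.sign σ) with hs | hs <;> simp [hs]
  · rw [← Matrix.det_permute']
    congr 1
    ext i j
    obtain ⟨s, rfl⟩ := (colEquiv h).surjective j
    simp only [Matrix.submatrix_apply, σ, Equiv.trans_apply, Equiv.symm_apply_apply,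
      frameMatrix_apply_colEquiv, id]
    rcases s with s | s <;> rfl

theorem continuousOn_det_frameMatrix {X : Type*} [TopologicalSpace X] {s : Set X} (h : k + l = n)
    {v : X → Fin k → EuclideanSpace ℝ (Fin n)} {w : X → Fin l → EuclideanSpace ℝ (Fin n)}
    (hv : ContinuousOn v s) (hw : ContinuousOn w s) :
    ContinuousOn (fun x => (frameMatrix h (v x) (w x)).det) s := by
  refine Continuous.comp_continuousOn (g := Matrix.det) (by fun_prop) ?_
  refine continuousOn_pi.2 fun i => continuousOn_pi.2 fun j => ?_
  obtain ⟨c, rfl⟩ := (colEquiv h).surjective j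
  simp only [frameMatrix_apply_colEquiv]
  rcases c with c | c
  · exact (EuclideanSpace.proj (𝕜 := ℝ) i).continuous.comp_continuousOn (continuousOn_pi.1 hv c)
  · exact (EuclideanSpace.proj (𝕜 := ℝ) i).continuous.comp_continuousOn (continuousOn_pi.1 hw c)

/-- Orthogonal projection maps a frame of a subspace to a frame of any close subspace of the same
dimension. -/
theorem frame_starProjection {E : Type*} [NormedAddCommGroup E] [InnerProductSpace ℝ E]
    [FiniteDimensional ℝ E] {V W : Submodule ℝ E} (hd : Module.finrank ℝ W = k)
    (hVW : ‖V.starProjection - W.starProjection‖ < 1) {v : Fin k → E}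
    (hv : LinearIndependent ℝ v) (hspan : Submodule.span ℝ (range v) = V) :
    LinearIndependent ℝ (fun i => W.starProjection (v i)) ∧
      Submodule.span ℝ (range fun i => W.starProjection (v i)) = W := by
  have hli : LinearIndependent ℝ (fun i => W.starProjection (v i)) := by
    refine hv.map_injOn W.starProjection.toLinearMap fun x hx y hy hxy => ?_
    rw [hspan] at hx hy
    refine sub_eq_zero.1 (starProjection_injOn_of_norm_sub_lt hVW _ (V.sub_mem hx hy) ?_)
    rw [map_sub]
    exact sub_eq_zero.2 hxy
  refine ⟨hli, Submodule.eq_of_le_of_finrank_eq ?_ ?_⟩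
  · rw [Submodule.span_le]
    rintro _ ⟨i, rfl⟩
    exact Submodule.starProjection_apply_mem _ _
  · rw [finrank_span_eq_card hli, hd, Fintype.card_fin]

/-- A continuous family of subspaces over a compact star-shaped set has a continuous frame. -/
theorem exists_frame_of_starConvex {E : Type*} [NormedAddCommGroup E] [InnerProductSpace ℝ E]
    [FiniteDimensional ℝ E] {Y : Type*} [NormedAddCommGroup Y] [NormedSpace ℝ Y] {K : Set Y}
    (hK : IsCompact K) (hstar : StarConvex ℝ 0 K) {G : Y → Submodule ℝ E}
    (hG : Continuous fun y => (G y).starProjection) (hd : ∀ y, Module.finrank ℝ (G y) = k) :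
    ∃ v : Y → Fin k → E, Continuous v ∧
      ∀ y ∈ K, LinearIndependent ℝ (v y) ∧ Submodule.span ℝ (range (v y)) = G y := by
  obtain ⟨δ, hδ, hGδ⟩ := Metric.uniformContinuousOn_iff.1
    (hK.uniformContinuousOn_of_continuous hG.continuousOn) 1 one_pos
  obtain ⟨R, hR⟩ := hK.isBounded.exists_norm_le
  obtain ⟨N, hN⟩ := exists_nat_gt (max R 0 / δ)
  have hN0 : (0 : ℝ) < N := lt_of_le_of_lt (by positivity) hN
  have hNδ : ∀ y ∈ K, ‖y‖ / N < δ := fun y hy => by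
    rw [div_lt_iff₀ hδ] at hN
    rw [div_lt_iff₀ hN0]
    linarith [hR y hy, le_max_left R 0]
  let b := Module.finBasisOfFinrankEq ℝ (G 0) (hd 0)
  -- The frame at the centre is carried outwards along each ray in `N` steps by orthogonal
  -- projection. Consecutive points are closer than `δ`, so consecutive projections differ by less
  -- than `1` in norm.
  have main : ∀ j : ℕ, ∃ v : Y → Fin k → E, Continuous v ∧ (j ≤ N → ∀ y ∈ K,
      LinearIndependent ℝ (v y) ∧
        Submodule.span ℝ (range (v y)) = G (((j : ℝ) / N) • y)) := by
    intro j
    induction j with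
    | zero =>
      refine ⟨fun _ i => b i, continuous_const, fun _ y _ => ⟨?_, ?_⟩⟩
      · exact b.linearIndependent.map' (G 0).subtype (Submodule.ker_subtype _)
      · have : range (fun i => (b i : E)) = (G 0).subtype '' range b := by
          rw [← range_comp]; rfl
        rw [this, Submodule.span_image, b.span_eq]
        simp
    | succ j ih =>
      obtain ⟨v, hvc, hv⟩ := ih
      refine ⟨fun y i => (G ((((j + 1 : ℕ) : ℝ) / N) • y)).starProjection (v y i), ?_, ?_⟩
      · refine continuous_pi fun i => Continuous.clm_apply ?_ ((continuous_apply i).comp hvc)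
        exact hG.comp (continuous_const_smul _)
      · intro hj y hy
        have hmem : ∀ i : ℕ, i ≤ N → ((i : ℝ) / N) • y ∈ K := fun i hi =>
          hstar.smul_mem hy (by positivity)
            (by rw [div_le_one hN0]; exact_mod_cast hi)
        obtain ⟨h1, h2⟩ := hv (by omega) y hy
        refine frame_starProjection (hd _) ?_ h1 h2
        rw [← dist_eq_norm]
        refine hGδ _ (hmem j (by omega)) _ (hmem (j + 1) hj) ?_
        rw [dist_eq_norm, ← sub_smul, norm_smul]
        have : ((j : ℝ) / N - ((j + 1 : ℕ) : ℝ) / N) = -(1 / N) := by push_cast; ring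
        rw [this, norm_neg, Real.norm_of_nonneg (by positivity), one_div_mul_eq_div]
        exact hNδ y hy
  obtain ⟨v, hvc, hv⟩ := main N
  refine ⟨v, hvc, fun y hy => ?_⟩
  have := hv le_rfl y hy
  rwa [div_self hN0.ne', one_smul] at this

end Frames

/-- The numbers are the values at the corners of the square and the products belong to its edges: a
closed circuit crosses from one sign to the other an even number of times. -/
theorem ite_mul_neg_modEq {a b c d : ℝ} (ha : a ≠ 0) (hb : b ≠ 0) (hc : c ≠ 0) (hd : d ≠ 0) :
    (if a * b < 0 then 1 else 0 : ℤ) ≡ (if a * c < 0 then 1 else 0) +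
      (if b * d < 0 then 1 else 0) + (if c * d < 0 then 1 else 0) [ZMOD 2] := by
  have key : ∀ {x y : ℝ}, x ≠ 0 → y ≠ 0 → (x * y < 0 ↔ ¬(x < 0 ↔ y < 0)) := by
    intro x y hx hy
    rcases hx.lt_or_gt with h | h <;> rcases hy.lt_or_gt with h' | h'
    · simp [h, h', (mul_pos_of_neg_of_neg h h').not_gt]
    · simp [h, h'.not_gt, mul_neg_of_neg_of_pos h h']
    · simp [h', h.not_gt, mul_neg_of_pos_of_neg h h']
    · simp [h.not_gt, h'.not_gt, (mul_pos h h').not_gt]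
  simp only [key ha hb, key ha hc, key hb hd, key hc hd]
  by_cases h1 : a < 0 <;> by_cases h2 : b < 0 <;> by_cases h3 : c < 0 <;> by_cases h4 : d < 0 <;>
    simp [h1, h2, h3, h4, Int.ModEq]

/-! ### Unstable families, transversality and the half-line index. -/

section MainTheorem

variable {n k : ℕ}

/-- The continuous family of unstable subspaces, completed by the positive spectral subspaces. -/
theorem exists_unstable_family {S : ℝ → ℝ → Matrix (Fin n) (Fin n) ℝ}
    {Sminus : ℝ → Matrix (Fin n) (Fin n) ℝ}
    (hS : ContinuousOn (fun p : ℝ × ℝ => S p.1 p.2) (Icc 0 1 ×ˢ univ))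
    (hminus : TendstoUniformlyOn (fun t lam => S lam t) Sminus atBot (Icc 0 1))
    (hyp : ∀ lam ∈ Icc (0 : ℝ) 1, IsHyperbolic (Sminus lam))
    (hd : ∀ lam ∈ Icc (0 : ℝ) 1, Module.finrank ℝ (Vplus (Sminus lam)) = k) :
    ∃ G : ℝ × ℝ → Submodule ℝ (EuclideanSpace ℝ (Fin n)),
      Continuous (fun p => (G p).starProjection) ∧ (∀ p, Module.finrank ℝ (G p) = k) ∧
      (∀ lam ∈ Icc (0 : ℝ) 1, ∀ t, 0 ≤ t →
        G (lam, t / (1 + t)) = unstableSubspace (S lam) (-t)) ∧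
      ∀ lam ∈ Icc (0 : ℝ) 1, G (lam, 1) = Vplus (Sminus lam) := by
  have hS' : ContinuousOn (fun p : ℝ × ℝ => -S p.1 (-p.2)) (Icc 0 1 ×ˢ univ) :=
    (hS.comp (f := fun p : ℝ × ℝ => (p.1, -p.2)) (by fun_prop)
      fun p hp => ⟨hp.1, mem_univ _⟩).neg
  have hplus' : TendstoUniformlyOn (fun t lam => -S lam (-t)) (fun lam => -Sminus lam) atTop
      (Icc 0 1) := by
    refine uniformContinuous_neg.comp_tendstoUniformlyOn
      (F := fun t lam => S lam (-t)) fun u hu => ?_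
    exact tendsto_neg_atTop_atBot.eventually (hminus u hu)
  obtain ⟨G, hG, hfin, h1, h2⟩ := exists_stable_family (d := k) hS' hplus'
    (fun lam hlam => (hyp lam hlam).neg)
    fun lam hlam => by rw [← Vplus_eq_Vminus_neg]; exact hd lam hlam
  refine ⟨G, hG, hfin, fun lam hlam t ht => ?_, fun lam hlam => ?_⟩
  · have hc : Continuous (S lam) :=
      hS.comp_continuous (f := fun t : ℝ => (lam, t)) (by fun_prop) fun t => ⟨hlam, mem_univ t⟩
    rw [h1 lam hlam t ht, unstableSubspace_neg hc]
  · rw [h2 lam hlam, Vplus_eq_Vminus_neg]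

/-- If only the zero solution decays at both ends, then the stable and unstable subspaces at time
`0` meet only at the origin. -/
theorem disjoint_stableSubspace_unstableSubspace {S : ℝ → Matrix (Fin n) (Fin n) ℝ}
    (hS : Continuous S)
    (h : ∀ u : ℝ → EuclideanSpace ℝ (Fin n), IsSolution S u → Tendsto u atBot (𝓝 0) →
      Tendsto u atTop (𝓝 0) → ∀ t, u t = 0) :
    Disjoint (stableSubspace S 0) (unstableSubspace S 0) := by
  have hγ : IsFundamentalSolution S 0 (fundamentalSolution S 0) :=
    Classical.epsilon_spec (exists_isFundamentalSolution hS 0)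
  rw [Submodule.disjoint_def]
  intro v hv hv'
  have := h _ (hγ.isLinearSolution v) hv' hv 0
  simpa [hγ.2] using this

theorem transversal_of_disjoint {V W : Submodule ℝ (EuclideanSpace ℝ (Fin n))}
    (hVW : Disjoint V W) (hd : Module.finrank ℝ V + Module.finrank ℝ W = n) :
    Transversal V W := by
  refine Submodule.eq_top_of_finrank_eq ?_
  have := Submodule.finrank_sup_add_finrank_inf_eq V W
  rw [hVW.eq_bot, finrank_bot] at this
  rw [finrank_euclideanSpace_fin]
  omega

theorem tendsto_div_one_add_atTop : Tendsto (fun t : ℝ => t / (1 + t)) atTop (𝓝 1) := by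
  have h : Tendsto (fun t : ℝ => 1 - (1 + t)⁻¹) atTop (𝓝 (1 - 0)) :=
    tendsto_const_nhds.sub (tendsto_inv_atTop_zero.comp (tendsto_atTop_add_const_left _ 1 tendsto_id))
  rw [sub_zero] at h
  refine h.congr' ?_
  filter_upwards [eventually_ge_atTop 0] with t ht
  have : 1 + t ≠ 0 := by positivity
  field_simp
  ring

theorem div_one_add_mem_Icc {t : ℝ} (ht : 0 ≤ t) : t / (1 + t) ∈ Icc (0 : ℝ) 1 :=
  ⟨by positivity, by rw [div_le_one (by positivity)]; linarith⟩

theorem continuousOn_div_one_add : ContinuousOn (fun t : ℝ => t / (1 + t)) (Ici 0) :=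
  ContinuousOn.div (by fun_prop) (by fun_prop) fun t ht => by
    have : (0 : ℝ) ≤ t := ht
    positivity

open Classical in
/-- The index over `[0, +∞)` of paths which extend continuously to `t = +∞`, with a transversal
limit. -/
theorem z2IndexIci_eq {l : ℕ} (h : l + k = n) {V W : ℝ → Submodule ℝ (EuclideanSpace ℝ (Fin n))}
    {v : ℝ → Fin l → EuclideanSpace ℝ (Fin n)} {w : ℝ → Fin k → EuclideanSpace ℝ (Fin n)}
    (hv : Continuous v) (hw : Continuous w)
    (hV : ∀ t, 0 ≤ t → LinearIndependent ℝ (v (t / (1 + t))) ∧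
      Submodule.span ℝ (range (v (t / (1 + t)))) = V t)
    (hW : ∀ t, 0 ≤ t → LinearIndependent ℝ (w (t / (1 + t))) ∧
      Submodule.span ℝ (range (w (t / (1 + t)))) = W t)
    (h1 : (frameMatrix h (v 1) (w 1)).det ≠ 0) :
    (∃ T, 0 < T ∧ ∀ t, T ≤ t → Transversal (V t) (W t)) ∧
    z2IndexIci V W 0 = if (frameMatrix h (v 0) (w 0)).det * (frameMatrix h (v 1) (w 1)).det < 0
      then 1 else 0 := by
  have hD : Continuous fun s => (frameMatrix h (v s) (w s)).det :=
    continuousOn_univ.1 (continuousOn_det_frameMatrix h hv.continuousOn hw.continuousOn)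
  have htrans : ∀ t, 0 ≤ t → (Transversal (V t) (W t) ↔
      (frameMatrix h (v (t / (1 + t))) (w (t / (1 + t)))).det ≠ 0) := fun t ht => by
    rw [det_frameMatrix_ne_zero_iff, (hV t ht).2, (hW t ht).2]
  have hex : ∃ T, 0 < T ∧ ∀ t, T ≤ t → Transversal (V t) (W t) := by
    have := ((hD.tendsto 1).comp tendsto_div_one_add_atTop).eventually_ne h1
    obtain ⟨T, hT⟩ := eventually_atTop.1 this
    refine ⟨max T 1, by positivity, fun t ht => ?_⟩
    have ht0 : 0 ≤ t := le_trans (by positivity) ht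
    exact (htrans t ht0).2 (hT t ((le_max_left _ _).trans ht))
  refine ⟨hex, ?_⟩
  rw [z2IndexIci, dif_pos hex]
  obtain ⟨hT0, hT⟩ := hex.choose_spec
  generalize hex.choose = T at hT0 hT
  have hsub : ContinuousOn (fun t : ℝ => t / (1 + t)) (Icc 0 T) :=
    continuousOn_div_one_add.mono Icc_subset_Ici_self
  rw [z2Index_eq hT0.le h (v := fun t => v (t / (1 + t))) (w := fun t => w (t / (1 + t)))
    ⟨hv.comp_continuousOn hsub, fun t ht => hV t ht.1⟩
    ⟨hw.comp_continuousOn hsub, fun t ht => hW t ht.1⟩]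
  have hσ : T / (1 + T) ≤ 1 := (div_one_add_mem_Icc hT0.le).2
  -- For `T / (1 + T) ≤ s < 1` the corresponding time `s / (1 - s)` is at least `T`, where the pair
  -- is transversal. The determinant has no zero up to `s = 1`, so the endpoint `T` may be replaced
  -- by `+∞`.
  have hpos : 0 < (frameMatrix h (v (T / (1 + T))) (w (T / (1 + T)))).det *
      (frameMatrix h (v 1) (w 1)).det := by
    refine mul_pos_of_continuousOn_ne_zero (f := fun s => (frameMatrix h (v s) (w s)).det)
      hσ hD.continuousOn fun s hs => ?_
    rcases hs.2.eq_or_lt with rfl | hs1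
    · exact h1
    · have hs0 : 0 < 1 - s := by linarith
      have hTs : T ≤ s / (1 - s) := by
        have := hs.1
        rw [div_le_iff₀ (by linarith)] at this
        rw [le_div_iff₀ hs0]
        linarith
      have hs2 : s / (1 - s) / (1 + s / (1 - s)) = s := by
        have : 1 + s / (1 - s) = 1 / (1 - s) := by field_simp; ring
        rw [this]
        field_simp
      have := (htrans _ (hT0.le.trans hTs)).1 (hT _ hTs)
      rwa [hs2] at this
  rw [zero_div]
  refine if_congr ⟨fun hneg => ?_, fun hneg => ?_⟩ rfl rfl
  · rcases pos_and_pos_or_neg_and_neg_of_mul_pos hpos with ⟨ha, hb⟩ | ⟨ha, hb⟩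
    · exact mul_neg_of_neg_of_pos (by nlinarith) hb
    · exact mul_neg_of_pos_of_neg (by nlinarith) hb
  · rcases pos_and_pos_or_neg_and_neg_of_mul_pos hpos with ⟨ha, hb⟩ | ⟨ha, hb⟩
    · exact mul_neg_of_neg_of_pos (by nlinarith) ha
    · exact mul_neg_of_pos_of_neg (by nlinarith) ha

end MainTheorem

end HeteroclinicParity

/-! ### The congruence of indices. -/

open HeteroclinicParity

/-- Decomposition of the `ℤ₂`-index of the unstable and stable subspaces. The first four conjuncts
say that the four indices occurring in the congruence are well defined. -/
theorem mainTheorem4 (n k : ℕ) (S : ℝ → ℝ → Matrix (Fin n) (Fin n) ℝ)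
    (Splus Sminus : ℝ → Matrix (Fin n) (Fin n) ℝ)
    -- (A1)
    (hS : ContinuousOn (fun p : ℝ × ℝ => S p.1 p.2) (Set.Icc 0 1 ×ˢ Set.univ))
    (hplus : TendstoUniformlyOn (fun t lam => S lam t) Splus Filter.atTop (Set.Icc 0 1))
    (hminus : TendstoUniformlyOn (fun t lam => S lam t) Sminus Filter.atBot (Set.Icc 0 1))
    (hypplus : ∀ lam ∈ Set.Icc (0 : ℝ) 1, HeteroclinicParity.IsHyperbolic (Splus lam))
    (hypminus : ∀ lam ∈ Set.Icc (0 : ℝ) 1, HeteroclinicParity.IsHyperbolic (Sminus lam))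
    -- (A2)
    (hA2 : ∀ lam ∈ ({0, 1} : Set ℝ), ∀ u : ℝ → EuclideanSpace ℝ (Fin n),
      HeteroclinicParity.IsSolution (S lam) u →
      Filter.Tendsto u Filter.atBot (nhds 0) → Filter.Tendsto u Filter.atTop (nhds 0) →
      ∀ t, u t = 0)
    -- (A3)
    (hA3 : ∀ lam ∈ Set.Icc (0 : ℝ) 1,
      Module.finrank ℝ (HeteroclinicParity.Vplus (Sminus lam)) = k ∧
      Module.finrank ℝ (HeteroclinicParity.Vminus (Splus lam)) = n - k)
    -- boundary nondegeneracy
    (hbd : ∀ lam ∈ ({0, 1} : Set ℝ), HeteroclinicParity.Transversal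
      (HeteroclinicParity.Vminus (Splus lam)) (HeteroclinicParity.Vplus (Sminus lam))) :
    HeteroclinicParity.IsTransversalPair
      (fun lam => HeteroclinicParity.unstableSubspace (S lam) 0)
      (fun lam => HeteroclinicParity.stableSubspace (S lam) 0) 0 1 k ∧
    (∀ lam ∈ ({0, 1} : Set ℝ), HeteroclinicParity.IsTransversalPairIci
      (fun t => HeteroclinicParity.stableSubspace (S lam) t)
      (fun t => HeteroclinicParity.unstableSubspace (S lam) (-t)) 0 (n - k)) ∧
    HeteroclinicParity.IsTransversalPair
      (fun lam => HeteroclinicParity.Vminus (Splus lam))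
      (fun lam => HeteroclinicParity.Vplus (Sminus lam)) 0 1 (n - k) ∧
    HeteroclinicParity.z2Index
        (fun lam => HeteroclinicParity.unstableSubspace (S lam) 0)
        (fun lam => HeteroclinicParity.stableSubspace (S lam) 0) 0 1 ≡
      HeteroclinicParity.geometricalParity (S 0) + HeteroclinicParity.geometricalParity (S 1) +
        HeteroclinicParity.z2Index
          (fun lam => HeteroclinicParity.Vminus (Splus lam))
          (fun lam => HeteroclinicParity.Vplus (Sminus lam)) 0 1 [ZMOD 2] := by
  classical
  have h0 : (0 : ℝ) ∈ Icc (0 : ℝ) 1 := by simp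
  have h1 : (1 : ℝ) ∈ Icc (0 : ℝ) 1 := by simp
  have hend : ∀ lam ∈ ({0, 1} : Set ℝ), lam ∈ Icc (0 : ℝ) 1 := by
    rintro lam (rfl | rfl)
    exacts [h0, h1]
  -- `k ≤ n` because `k` is the dimension of a subspace, so the truncated subtraction is harmless.
  have hkn : n - k + k = n := by
    have hle := Submodule.finrank_le (Vplus (Sminus 0))
    rw [(hA3 0 h0).1, finrank_euclideanSpace_fin] at hle
    omega
  obtain ⟨Gs, hGs, hGs_dim, hGs_t, hGs_1⟩ :=
    exists_stable_family hS hplus hypplus fun lam hlam => (hA3 lam hlam).2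
  obtain ⟨Gu, hGu, hGu_dim, hGu_t, hGu_1⟩ :=
    exists_unstable_family hS hminus hypminus fun lam hlam => (hA3 lam hlam).1
  have hGs_0 : ∀ lam ∈ Icc (0 : ℝ) 1, Gs (lam, 0) = stableSubspace (S lam) 0 := fun lam hlam => by
    simpa using hGs_t lam hlam 0 le_rfl
  have hGu_0 : ∀ lam ∈ Icc (0 : ℝ) 1, Gu (lam, 0) = unstableSubspace (S lam) 0 :=
    fun lam hlam => by simpa using hGu_t lam hlam 0 le_rfl
  have hKc : IsCompact (Icc (0 : ℝ) 1 ×ˢ Icc (0 : ℝ) 1) := isCompact_Icc.prod isCompact_Icc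
  have hKs : StarConvex ℝ (0 : ℝ × ℝ) (Icc (0 : ℝ) 1 ×ˢ Icc (0 : ℝ) 1) :=
    ((convex_Icc (0 : ℝ) 1).prod (convex_Icc (0 : ℝ) 1)).starConvex ⟨h0, h0⟩
  obtain ⟨v, hvc, hv⟩ := exists_frame_of_starConvex hKc hKs hGs hGs_dim
  obtain ⟨w, hwc, hw⟩ := exists_frame_of_starConvex hKc hKs hGu hGu_dim
  -- All four indices are read off from this one function, along the four edges of the square.
  let D : ℝ × ℝ → ℝ := fun p => (frameMatrix hkn (v p) (w p)).det
  have hD : ∀ p ∈ Icc (0 : ℝ) 1 ×ˢ Icc (0 : ℝ) 1, (D p ≠ 0 ↔ Transversal (Gs p) (Gu p)) :=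
    fun p hp => by
      rw [← (hv p hp).2, ← (hw p hp).2]
      exact det_frameMatrix_ne_zero_iff hkn
  -- (A2) only gives trivial intersection; complementary dimensions turn it into transversality.
  have ht0 : ∀ lam ∈ ({0, 1} : Set ℝ), Transversal (Gs (lam, 0)) (Gu (lam, 0)) := by
    intro lam hlam
    have hc : Continuous (S lam) := hS.comp_continuous (f := fun t : ℝ => (lam, t)) (by fun_prop)
      fun t => ⟨hend lam hlam, mem_univ t⟩
    refine transversal_of_disjoint ?_ (by rw [hGs_dim, hGu_dim, hkn])
    rw [hGs_0 lam (hend lam hlam), hGu_0 lam (hend lam hlam)]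
    exact disjoint_stableSubspace_unstableSubspace hc (hA2 lam hlam)
  have ht1 : ∀ lam ∈ ({0, 1} : Set ℝ), Transversal (Gs (lam, 1)) (Gu (lam, 1)) := by
    intro lam hlam
    rw [hGs_1 lam (hend lam hlam), hGu_1 lam (hend lam hlam)]
    exact hbd lam hlam
  have hD0 : ∀ lam ∈ ({0, 1} : Set ℝ), D (lam, 0) ≠ 0 := fun lam hlam =>
    (hD (lam, 0) ⟨hend lam hlam, h0⟩).2 (ht0 lam hlam)
  have hD1 : ∀ lam ∈ ({0, 1} : Set ℝ), D (lam, 1) ≠ 0 := fun lam hlam =>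
    (hD (lam, 1) ⟨hend lam hlam, h1⟩).2 (ht1 lam hlam)
  have hgeo : ∀ lam ∈ ({0, 1} : Set ℝ),
      (∃ T, 0 < T ∧ ∀ t, T ≤ t →
        Transversal (stableSubspace (S lam) t) (unstableSubspace (S lam) (-t))) ∧
      geometricalParity (S lam) = if D (lam, 0) * D (lam, 1) < 0 then 1 else 0 := by
    intro lam hlam
    refine z2IndexIci_eq hkn (v := fun s => v (lam, s)) (w := fun s => w (lam, s))
      (by fun_prop) (by fun_prop) (fun t ht => ?_) (fun t ht => ?_) (hD1 lam hlam)
    · rw [← hGs_t lam (hend lam hlam) t ht]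
      exact hv _ ⟨hend lam hlam, div_one_add_mem_Icc ht⟩
    · rw [← hGu_t lam (hend lam hlam) t ht]
      exact hw _ ⟨hend lam hlam, div_one_add_mem_Icc ht⟩
  refine ⟨⟨?_, ?_, ?_, ?_, ?_, ?_⟩, fun lam hlam => ⟨?_, ?_, ?_, ?_, ?_, (hgeo lam hlam).1⟩,
    ⟨?_, ?_, ?_, ?_, hbd 0 (by simp), hbd 1 (by simp)⟩, ?_⟩
  · exact (hGu.comp (Continuous.prodMk_left 0)).continuousOn.congr fun lam hlam => by
      simp [hGu_0 lam hlam]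
  · exact (hGs.comp (Continuous.prodMk_left 0)).continuousOn.congr fun lam hlam => by
      simp [hGs_0 lam hlam]
  · exact fun lam hlam => by rw [← hGu_0 lam hlam, hGu_dim]
  · exact fun lam hlam => by rw [← hGs_0 lam hlam, hGs_dim]
  · have := ht0 0 (by simp)
    rw [hGs_0 0 h0, hGu_0 0 h0, Transversal, sup_comm] at this
    exact this
  · have := ht0 1 (by simp)
    rw [hGs_0 1 h1, hGu_0 1 h1, Transversal, sup_comm] at this
    exact this
  · refine ((hGs.comp (Continuous.prodMk_right lam)).comp_continuousOn
      continuousOn_div_one_add).congr fun t ht => ?_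
    simp [hGs_t lam (hend lam hlam) t ht]
  · refine ((hGu.comp (Continuous.prodMk_right lam)).comp_continuousOn
      continuousOn_div_one_add).congr fun t ht => ?_
    simp [hGu_t lam (hend lam hlam) t ht]
  · exact fun t ht => by rw [← hGs_t lam (hend lam hlam) t ht, hGs_dim]
  · exact fun t ht => by
      rw [← hGu_t lam (hend lam hlam) t ht, hGu_dim]
      omega
  · have := ht0 lam hlam
    rw [hGs_0 lam (hend lam hlam), hGu_0 lam (hend lam hlam)] at this
    simpa using this
  · exact (hGs.comp (Continuous.prodMk_left 1)).continuousOn.congr fun lam hlam => by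
      simp [hGs_1 lam hlam]
  · exact (hGu.comp (Continuous.prodMk_left 1)).continuousOn.congr fun lam hlam => by
      simp [hGu_1 lam hlam]
  · exact fun lam hlam => (hA3 lam hlam).2
  · exact fun lam hlam => by rw [(hA3 lam hlam).1]; omega
  -- The index on the left lists `E^u` before `E^s`, opposite to `D`. The resulting sign `ε` occurs
  -- at both ends and squares to one.
  · obtain ⟨ε, hε, hswap⟩ := exists_sign_det_frameMatrix_swap (h := (by omega : k + (n - k) = n)) hkn
    rw [(hgeo 0 (by simp)).2, (hgeo 1 (by simp)).2,
      z2Index_eq zero_le_one (by omega : k + (n - k) = n)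
        (v := fun lam => w (lam, 0)) (w := fun lam => v (lam, 0))
        ⟨by fun_prop, fun lam hlam => hGu_0 lam hlam ▸ hw _ ⟨hlam, h0⟩⟩
        ⟨by fun_prop, fun lam hlam => hGs_0 lam hlam ▸ hv _ ⟨hlam, h0⟩⟩,
      z2Index_eq zero_le_one hkn (v := fun lam => v (lam, 1)) (w := fun lam => w (lam, 1))
        ⟨by fun_prop, fun lam hlam => hGs_1 lam hlam ▸ hv _ ⟨hlam, h1⟩⟩
        ⟨by fun_prop, fun lam hlam => hGu_1 lam hlam ▸ hw _ ⟨hlam, h1⟩⟩]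
    have hsign : ∀ a b : ℝ, ε * a * (ε * b) = a * b := fun a b => by
      rw [mul_mul_mul_comm, hε, one_mul]
    simp only [hswap, hsign]
    exact ite_mul_neg_modEq (hD0 0 (by simp)) (hD0 1 (by simp)) (hD1 0 (by simp)) (hD1 1 (by simp))
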